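/- A unit loop is a closed rectifiable curve $\gamma$ in $\mathbb{R}^3$ with $\mathcal{H}^1(\gamma)=1$, parametrized by arclength: $\gamma:\mathbb{R}\to\mathbb{R}^3$ is $1$-periodic and Lipschitz with $|\gamma'|=1$ almost everywhere. It is simple if $\gamma$ is injective on $[0,1)$. Let $R(x,y,z)$ be the radius of the circle through $x,y,z$ ($R=\infty$ for collinear points), and put $$\varrho[\gamma](x,y)=\inf_{z} R(x,y,z),\qquad \varrho_G[\gamma](x)=\inf_{y,z} R(x,y,z),$$ the infima being over points of the curve such that $x,y,z$ are distinct. Let $r_{\rm tp}[\gamma](x,y)$ be the radius of the circle through $x$ and $y$ that is tangent to $\gamma$ at $x$ ($\infty$ if $y$ lies on the tangent line at $x$). For real $p$ consider, with all integrals taken with respect to $\mathcal{H}^1$ over the curve, $$\mathscr{M}_p(\gamma)=\iiint \frac{1}{R(x,y,z)^{p}},\quad \mathscr{I}_p(\gamma)=\iint \frac{1}{\varrho[\gamma](x,y)^{p}},\quad \mathscr{U}_p(\gamma)=\int \frac{1}{\varrho_G[\gamma](x)^{p}},$$ $$\mathscr{E}_p(\gamma)=\iint \frac{1}{r_{\rm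 tp}[\gamma](x,y)^{p}},\quad \mathscr{E}^{\rm sym}_p(\gamma)=\iint \frac{1}{\big(r_{\rm tp}[\gamma](x,y)\,r_{\rm tp}[\gamma](y,x)\big)^{p/2}}.$$ **Theorem 4.1.** Let $\mathscr{F}_p$ be one of these energies, let $p_0=3$ for $\mathscr{M}_p$, $p_0=2$ for $\mathscr{I}_p,\mathscr{E}_p,\mathscr{E}^{\rm sym}_p$ and $p_0=1$ for $\mathscr{U}_p$, let $p>p_0$, and put $\beta=1/(p-p_0)$. There is a constant $\delta\in(0,1)$, depending only on $p$ and on which of the five energies is taken, with the following property. Let $\gamma$ be a simple unit loop with $\mathscr{F}_p(\gamma)<\infty$, and let $t_0<t_1<\dots<t_N=t_0+1$ be parameters such that the points $x_i=\gamma(t_i)$ satisfy $$|x_{i}-x_{i+1}|<\delta\,\mathscr{F}_p(\gamma)^{-\beta}\quad\text{and}\quad t_{i+1}-t_i\le \tfrac12\qquad(0\le i<N).$$ Then $\gamma$ is ambient isotopic to the closed inscribed polygon $\bigcup_{i=0}^{N-1}[x_i,x_{i+1}]$. That is, there is a continuous family of homeomorphisms $H_s$ of $\mathbb{R}^3$,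 $s\in[0,1]$, such that $H_0$ is the identity and $H_1$ maps the curve onto the polygon. -/

import Mathlib

open MeasureTheory Set
open scoped ENNReal

namespace MengerKnot

noncomputable section

/-- Euclidean three-space. -/
abbrev E3 : Type := EuclideanSpace ℝ (Fin 3)

/-- A closed curve of length one, parametrized by arclength. A map on `[0,1]` with equal values
at both ends is written as a `1`-periodic map on `ℝ`, so that `range γ` is the curve `γ([0,1])`. -/
structure IsUnitLoop (γ : ℝ → E3) : Prop where
  periodic : Function.Periodic γ 1
  lipschitz : LipschitzWith 1 γ
  unit_speed : ∀ᵐ t : ℝ, ‖deriv γ t‖ = 1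
  length_one : μH[1] (range γ) = 1

/-- The loop is a simple closed curve. -/
def IsSimpleLoop (γ : ℝ → E3) : Prop := InjOn γ (Ico (0 : ℝ) 1)

open Classical in
/-- The radius `R(x,y,z)` of the circle through three points; it is `∞` if they are collinear. -/
def circleRadius (x y z : E3) : ℝ≥0∞ :=
  if h : AffineIndependent ℝ ![x, y, z] then
    ENNReal.ofReal (Affine.Simplex.circumradius ⟨![x, y, z], h⟩)
  else ∞

/-- The infimum of `R(x,y,z)` over the points `z` of `Γ`, with `x`, `y`, `z` distinct. -/
def radiusInf (Γ : Set E3) (x y : E3) : ℝ≥0∞ :=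
  ⨅ z ∈ {z : E3 | z ∈ Γ ∧ z ≠ x ∧ x ≠ y ∧ y ≠ z}, circleRadius x y z

/-- The global radius of curvature: the infimum of `R(x,y,z)` over the points `y`, `z` of `Γ`,
with `x`, `y`, `z` distinct. -/
def globalRadius (Γ : Set E3) (x : E3) : ℝ≥0∞ :=
  ⨅ y ∈ Γ, radiusInf Γ x y

/-- The tangent vector of a simple loop at its point `x`: the derivative at the parameter
in `[0,1)` that belongs to `x`. -/
def tangentAt (γ : ℝ → E3) (x : E3) : E3 :=
  deriv γ (Function.invFunOn γ (Ico (0 : ℝ) 1) x)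

/-- The tangent line of a simple loop at its point `x`. -/
def tangentLine (γ : ℝ → E3) (x : E3) : Set E3 :=
  range fun τ : ℝ => x + τ • tangentAt γ x

/-- The tangent-point radius: the radius `|x - y|² / (2 dist(y, ℓ(x)))` of the circle through
`x` and `y` that is tangent to the curve at `x`, where `ℓ(x)` is the tangent line at `x`.
It is `∞` if `y ≠ x` lies on that line. -/
def tangentPointRadius (γ : ℝ → E3) (x y : E3) : ℝ≥0∞ :=
  ENNReal.ofReal (dist x y ^ 2) / ENNReal.ofReal (2 * Metric.infDist y (tangentLine γ x))

/-- The five families of curvature energies. -/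
inductive CurvatureEnergy where
  /-- integral Menger curvature, a triple integral -/
  | M
  /-- the double integral with one minimization -/
  | I
  /-- the `L^p`-norm of global curvature, a single integral -/
  | U
  /-- the tangent-point energy -/
  | TP
  /-- the symmetrized tangent-point energy -/
  | TPsym

/-- The exponent for which the energy is invariant under scaling. -/
def CurvatureEnergy.criticalExponent : CurvatureEnergy → ℝ
  | .M => 3
  | .I => 2
  | .U => 1
  | .TP => 2
  | .TPsym => 2

/-- The energy with exponent `p` of a loop; all integrals are over the curve `range γ`
with respect to the one-dimensional Hausdorff measure. -/
def CurvatureEnergy.energy (p : ℝ) (γ : ℝ → E3) : CurvatureEnergy → ℝ≥0∞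
  | .M => ∫⁻ x in range γ, ∫⁻ y in range γ, ∫⁻ z in range γ,
      ((circleRadius x y z) ^ p)⁻¹ ∂μH[1] ∂μH[1] ∂μH[1]
  | .I => ∫⁻ x in range γ, ∫⁻ y in range γ, ((radiusInf (range γ) x y) ^ p)⁻¹ ∂μH[1] ∂μH[1]
  | .U => ∫⁻ x in range γ, ((globalRadius (range γ) x) ^ p)⁻¹ ∂μH[1]
  | .TP => ∫⁻ x in range γ, ∫⁻ y in range γ, ((tangentPointRadius γ x y) ^ p)⁻¹ ∂μH[1] ∂μH[1]
  | .TPsym => ∫⁻ x in range γ, ∫⁻ y in range γ,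
      ((tangentPointRadius γ x y * tangentPointRadius γ y x) ^ (p / 2))⁻¹ ∂μH[1] ∂μH[1]

/-- Parameters `t 0 < t 1 < ... < t N` of successive vertices once around a `1`-periodic curve;
since `t N = t 0 + 1`, the vertex number `N` is the vertex number `0` again. -/
def IsCyclicPartition {N : ℕ} (t : Fin (N + 1) → ℝ) : Prop :=
  StrictMono t ∧ t (Fin.last N) = t 0 + 1

/-- The closed polygon whose edges join the points of the curve at successive parameters. -/
def inscribedPolygon (γ : ℝ → E3) {N : ℕ} (t : Fin (N + 1) → ℝ) : Set E3 :=
  ⋃ i : Fin N, segment ℝ (γ (t i.castSucc)) (γ (t i.succ))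

/-- Two subsets of a space are ambient isotopic if some isotopy of the whole space, that is, a
continuous family of homeomorphisms starting at the identity, takes one onto the other. -/
def AmbientIsotopic {X : Type*} [TopologicalSpace X] (A B : Set X) : Prop :=
  ∃ H : unitInterval → (X ≃ₜ X),
    Continuous (fun q : unitInterval × X => H q.1 q.2) ∧
    (∀ x, H 0 x = x) ∧ H 1 '' A = B

end

end MengerKnot

/-!
Finite energy forces the loop to be nearly straight at every scale below `c * E ^ (-β)`, where `E`
is the energy, and a nearly straight loop differs from an inscribed polygon by a small Lipschitz
displacement, which extends to an isotopy of the whole space.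

*Flatness from energy.* If the loop has points `x`, `y`, `z` with `|x - y| ≤ |x - z| ≤ 2 |x - y|`
for which `z` has distance `h` from the line `xy`, then all triangles with vertices within a small
multiple of `h` of `x`, `y`, `z` are equally thick, and the loop has length at least `ρ` in each
ball of radius `ρ` about one of its points. So `E ≥ C h ^ q (h / d ^ 2) ^ p` with `d = |x - y|` and
the critical exponent `q` (`CurvatureEnergy.exists_le_energy`). For the tangent-point energies one
adds four points of the loop at distances `d / 4, …, d` from `x`. If for nearly all choices of
points near these seven, one point of any two were near the line at the other, the tournament on
the four points would contain a transitive triple `i → j`, `i → k`, `j → k`. The lines at `i` and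
at `j` then agree, and every further point is near that common line, because it is near the line at
`i`, or near the line at `j`, or its own line passes near both `i` and `j`. This contradicts the
thickness of the triangle (`exists_near_line_of_tournament`, `exists_le_measure_farPairs`). Hence a
definite amount of pairs are far from each other's lines. The argument uses only that the tangent
lines are measurable, so the arbitrary value of the tangent at points of non-differentiability is
harmless.

*Straightness.* As `p > q`, the bound says that `h / d` is at most a multiple of a positive power of
`d`. Summing over the scales `d, d / 2, d / 4, …` shows that any two points are seen from a third
one in directions that agree up to sign and a small error (`straight_of_flat`,
`CurvatureEnergy.exists_straight`).

*Order on the loop.* By continuity the sign cannot switch along an arc, so short arcs are graphs of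
small slope over their chords and hardly longer than these (`Straight.sub_le_dist`), and points
close in space are close along the loop (`Straight.exists_int_abs_le`), since a second strand would
produce an isosceles triangle with two nearly right angles.

*Isotopy.* Let the polygon be parametrized affinely on each parameter interval. The difference
between loop and polygon has a small Lipschitz constant in the parameter
(`Straight.norm_chordGap_sub_chordGap_le`), hence as a function on the curve in space. It extends to
a contraction `Ψ` of three-space, and `x ↦ x - s • Ψ x`, for `s` from `0` to `1`, is the isotopy
(`AmbientIsotopic.of_lipschitzWith`, `Straight.ambientIsotopic`).
-/

namespace MengerKnot

/-! ### Directions of chords -/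

section Dir

variable {V : Type*} [NormedAddCommGroup V] [InnerProductSpace ℝ V]

/-- The unit vector pointing from `x` to `y`; it is `0` if `x = y`. -/
noncomputable def dir (x y : V) : V := NormedSpace.normalize (y - x)

lemma dir_swap (x y : V) : dir y x = -dir x y := by
  rw [dir, dir, ← NormedSpace.normalize_neg, neg_sub]

lemma norm_dir {x y : V} (h : y ≠ x) : ‖dir x y‖ = 1 :=
  NormedSpace.norm_normalize_eq_one_iff.2 (sub_ne_zero.2 h)

lemma dist_smul_dir (x y : V) : dist x y • dir x y = y - x := by
  rw [dist_comm, dist_eq_norm, dir, NormedSpace.norm_smul_normalize]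

lemma inner_eq_of_norm_one {u v : V} (hu : ‖u‖ = 1) (hv : ‖v‖ = 1) :
    inner ℝ u v = 1 - ‖u - v‖ ^ 2 / 2 := by
  rw [norm_sub_sq_real, hu, hv]; ring

lemma norm_sub_add_norm_add_ge {u : V} (hu : ‖u‖ = 1) (v : V) : 2 ≤ ‖u - v‖ + ‖u + v‖ := by
  have h := norm_add_le (u - v) (u + v)
  rwa [show u - v + (u + v) = (2 : ℝ) • u by rw [two_smul]; abel, norm_smul, hu,
    Real.norm_eq_abs, abs_two, mul_one] at h

/-- A set is `ε`-straight at scale `r` if any two of its points that lie within distance `r` of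
a third one are seen from there along lines that form an angle of about `ε` at most. The
directions may be opposite, hence the alternative. -/
def Straight (Γ : Set V) (ε r : ℝ) : Prop :=
  ∀ x ∈ Γ, ∀ y ∈ Γ, ∀ z ∈ Γ, y ≠ x → z ≠ x → dist x y ≤ r → dist x z ≤ r →
    ‖dir x y - dir x z‖ ≤ ε ∨ ‖dir x y + dir x z‖ ≤ ε

/-- Along a connected piece of a curve the alternative in `Straight` cannot switch. -/
lemma Straight.norm_dir_sub_dir_le {γ : ℝ → V} {ε r : ℝ} (hS : Straight (range γ) ε r)
    (hγ : Continuous γ) (hε : ε < 1) {x : V} (hx : x ∈ range γ) {T : Set ℝ}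
    (hT : IsPreconnected T) (hne : ∀ t ∈ T, γ t ≠ x) (hd : ∀ t ∈ T, dist x (γ t) ≤ r)
    {t t' : ℝ} (ht : t ∈ T) (ht' : t' ∈ T) : ‖dir x (γ t) - dir x (γ t')‖ ≤ ε := by
  set f : ℝ → ℝ := fun τ => ‖dir x (γ t) - dir x (γ τ)‖ with hf
  have key : ∀ τ ∈ T, f τ ≤ ε ∨ 2 - ε ≤ f τ := fun τ hτ => by
    refine (hS x hx _ ⟨t, rfl⟩ _ ⟨τ, rfl⟩ (hne t ht) (hne τ hτ) (hd t ht) (hd τ hτ)).imp_right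
      fun h => ?_
    have := norm_sub_add_norm_add_ge (norm_dir (hne t ht)) (dir x (γ τ))
    simp only [hf]; linarith
  have hcont : ContinuousOn f T := by
    refine (continuousOn_const.sub ?_).norm
    have : ContinuousOn (fun τ => γ τ - x) T := (hγ.sub continuous_const).continuousOn
    exact (this.norm.inv₀ fun τ hτ => norm_ne_zero_iff.2 (sub_ne_zero.2 (hne τ hτ))).smul this
  rcases key t' ht' with h | h
  · exact h
  · have h0 : f t = 0 := by simp [hf]
    obtain ⟨τ, hτ, h1⟩ := hT.intermediate_value ht ht' hcont
      (show (1 : ℝ) ∈ Icc (f t) (f t') from ⟨by rw [h0]; norm_num, by linarith⟩)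
    rcases key τ hτ with h' | h' <;> linarith

end Dir

/-! ### Simple loops -/

lemma IsUnitLoop.map_add_int {γ : ℝ → E3} (hγ : IsUnitLoop γ) (t : ℝ) (m : ℤ) :
    γ (t + m) = γ t := by
  simpa using hγ.periodic.int_mul m t

lemma IsUnitLoop.dist_le {γ : ℝ → E3} (hγ : IsUnitLoop γ) (s t : ℝ) :
    dist (γ s) (γ t) ≤ |t - s| := by
  simpa [Real.dist_eq, abs_sub_comm] using hγ.lipschitz.dist_le_mul s t

lemma IsSimpleLoop.exists_int_of_eq {γ : ℝ → E3} (hs : IsSimpleLoop γ) (hγ : IsUnitLoop γ)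
    {s t : ℝ} (h : γ s = γ t) : ∃ m : ℤ, t + m = s := by
  have hf : ∀ x, γ (Int.fract x) = γ x := fun x => by
    have := hγ.map_add_int (Int.fract x) ⌊x⌋
    rw [Int.fract_add_floor] at this
    exact this.symm
  have hI : ∀ x : ℝ, Int.fract x ∈ Ico (0 : ℝ) 1 := fun x => ⟨Int.fract_nonneg x, Int.fract_lt_one x⟩
  have := hs (hI s) (hI t) (by rw [hf, hf, h])
  refine ⟨⌊s⌋ - ⌊t⌋, ?_⟩
  have h1 := Int.fract_add_floor s
  have h2 := Int.fract_add_floor t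
  push_cast; linarith

lemma IsSimpleLoop.ne {γ : ℝ → E3} (hs : IsSimpleLoop γ) (hγ : IsUnitLoop γ)
    {s t : ℝ} (h : s < t) (h' : t < s + 1) : γ t ≠ γ s := fun he => by
  obtain ⟨m, hm⟩ := hs.exists_int_of_eq hγ he
  have h1 : (0 : ℝ) < (m : ℤ) := by linarith
  have h2 : ((m : ℤ) : ℝ) < 1 := by linarith
  have h1' : (0 : ℤ) < m := by exact_mod_cast h1
  have h2' : m < (1 : ℤ) := by exact_mod_cast h2
  omega

/-- An arc has at least the length of its parameter interval: otherwise the loop, being the union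
of this arc and of the `1`-Lipschitz image of the rest of a period, would be too short. -/
lemma IsUnitLoop.le_measure_image {γ : ℝ → E3} (hγ : IsUnitLoop γ) {s t : ℝ}
    (h' : t ≤ s + 1) : ENNReal.ofReal (t - s) ≤ μH[1] (γ '' Icc s t) := by
  rcases lt_or_ge t s with h | h
  · rw [ENNReal.ofReal_of_nonpos (by linarith)]; exact zero_le
  have hR : range γ = γ '' Icc s t ∪ γ '' Icc t (s + 1) := by
    rw [← image_union, Icc_union_Icc_eq_Icc h h', hγ.periodic.image_Icc one_pos]
  have h1 : μH[1] (γ '' Icc t (s + 1)) ≤ ENNReal.ofReal (s + 1 - t) := by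
    have := hγ.lipschitz.hausdorffMeasure_image_le zero_le_one (Icc t (s + 1))
    rwa [hausdorffMeasure_real, Real.volume_Icc, ENNReal.coe_one, ENNReal.one_rpow, one_mul] at this
  have h2 : (1 : ℝ≥0∞) ≤ μH[1] (γ '' Icc s t) + ENNReal.ofReal (s + 1 - t) := by
    rw [← hγ.length_one, hR]
    exact (measure_union_le _ _).trans (add_le_add_right h1 _)
  have h3 : (1 : ℝ≥0∞) = ENNReal.ofReal (t - s) + ENNReal.ofReal (s + 1 - t) := by
    rw [← ENNReal.ofReal_add (by linarith) (by linarith)]; simp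
  rw [h3] at h2
  exact (ENNReal.add_le_add_iff_right ENNReal.ofReal_ne_top).1 h2

/-- The scale at which a simple loop is straight is less than its length: the loop has to turn
around somewhere. -/
lemma Straight.lt_one {γ : ℝ → E3} (hγ : IsUnitLoop γ) (hs : IsSimpleLoop γ) {ε r : ℝ}
    (hS : Straight (range γ) ε r) (hε : ε ≤ 1 / 2) : r < 1 := by
  by_contra! hr
  have hc := hγ.lipschitz.continuous
  -- Otherwise every angle of every inscribed triangle would be small.
  have key : ∀ s t t' : ℝ, t ∈ Ioo s (s + 1) → t' ∈ Ioo s (s + 1) →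
      ‖dir (γ s) (γ t) - dir (γ s) (γ t')‖ ≤ ε := fun s t t' ht ht' =>
    hS.norm_dir_sub_dir_le hc (by linarith) ⟨s, rfl⟩ isPreconnected_Ioo
      (fun τ hτ => hs.ne hγ hτ.1 hτ.2)
      (fun τ hτ => (hγ.dist_le s τ).trans (by rw [abs_of_pos (by linarith [hτ.1])]; linarith [hτ.2]))
      ht ht'
  have h0 := key 0 (1/3) (2/3) ⟨by norm_num, by norm_num⟩ ⟨by norm_num, by norm_num⟩
  have h1 := key (1/3) (2/3) 1 ⟨by norm_num, by norm_num⟩ ⟨by norm_num, by norm_num⟩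
  have h2 := key (2/3) 1 (4/3) ⟨by norm_num, by norm_num⟩ ⟨by norm_num, by norm_num⟩
  have e1 : γ 1 = γ 0 := by simpa using hγ.periodic 0
  have e2 : γ (4/3) = γ (1/3) := by
    have := hγ.periodic (1/3); norm_num at this ⊢; exact this
  rw [e1] at h1 h2
  rw [e2] at h2
  have hn : ‖dir (γ 0) (γ (1/3))‖ = 1 :=
    norm_dir (hs.ne hγ (by norm_num) (by norm_num))
  rw [dir_swap (γ 0) (γ (1/3))] at h1
  rw [dir_swap (γ 0) (γ (2/3)), dir_swap (γ (1/3)) (γ (2/3))] at h2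
  set a := dir (γ 0) (γ (1/3))
  set b := dir (γ 0) (γ (2/3))
  set c := dir (γ (1/3)) (γ (2/3))
  have : (2 : ℝ) • a = (a - b) + (c - -a) - (- b - -c) + (0 : E3) := by rw [two_smul]; abel
  have h3 : ‖(2 : ℝ) • a‖ ≤ ε + ε + ε := by
    rw [this, add_zero]
    exact (norm_sub_le _ _).trans (add_le_add ((norm_add_le _ _).trans (add_le_add h0 h1)) h2)
  rw [norm_smul, hn, Real.norm_eq_abs, abs_two] at h3
  linarith

/-- All chords of a short arc of a straight loop have nearly the same direction. -/
lemma Straight.norm_dir_sub_dir_window {γ : ℝ → E3} (hγ : IsUnitLoop γ) (hs : IsSimpleLoop γ)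
    {ε r : ℝ} (hS : Straight (range γ) ε r) (hε : ε ≤ 1 / 2) {p q a b : ℝ} (hpa : p ≤ a)
    (hab : a < b) (hbq : b ≤ q) (hpq : q - p ≤ r) :
    ‖dir (γ a) (γ b) - dir (γ p) (γ q)‖ ≤ 2 * ε := by
  have hr := hS.lt_one hγ hs hε
  have hc := hγ.lipschitz.continuous
  have h1 : ‖dir (γ a) (γ b) - dir (γ a) (γ q)‖ ≤ ε :=
    hS.norm_dir_sub_dir_le hc (by linarith) ⟨a, rfl⟩ (isPreconnected_Ioc (a := a) (b := q))
      (fun τ hτ => hs.ne hγ hτ.1 (by linarith [hτ.2]))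
      (fun τ hτ => (hγ.dist_le a τ).trans (by rw [abs_of_pos (by linarith [hτ.1])]; linarith [hτ.2]))
      ⟨hab, hbq⟩ ⟨by linarith, le_rfl⟩
  have h2 : ‖dir (γ q) (γ a) - dir (γ q) (γ p)‖ ≤ ε :=
    hS.norm_dir_sub_dir_le hc (by linarith) ⟨q, rfl⟩ (isPreconnected_Ico (a := p) (b := q))
      (fun τ hτ => (hs.ne hγ hτ.2 (by linarith [hτ.1])).symm)
      (fun τ hτ => (hγ.dist_le q τ).trans (by rw [abs_of_neg (by linarith [hτ.2])]; linarith [hτ.1]))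
      ⟨hpa, by linarith⟩ ⟨le_rfl, by linarith⟩
  rw [dir_swap (γ a), dir_swap (γ p), ← norm_neg, neg_sub, sub_neg_eq_add, neg_add_eq_sub] at h2
  calc _ = ‖(dir (γ a) (γ b) - dir (γ a) (γ q)) + (dir (γ a) (γ q) - dir (γ p) (γ q))‖ := by
        congr 1; abel
    _ ≤ ε + ε := (norm_add_le _ _).trans (add_le_add h1 h2)
    _ = 2 * ε := by ring

/-- A map that shrinks distances on `S` by a factor `K` at most does so with Hausdorff measures. -/
lemma hausdorffMeasure_le_of_dist_le {X Y : Type*} [MetricSpace X] [MeasurableSpace X]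
    [BorelSpace X] [MetricSpace Y] [MeasurableSpace Y] [BorelSpace Y] {f : X → Y} {S : Set X}
    {K : NNReal} (h : ∀ x ∈ S, ∀ y ∈ S, dist x y ≤ K * dist (f x) (f y)) {d : ℝ} (hd : 0 ≤ d) :
    μH[d] S ≤ (K : ℝ≥0∞) ^ d * μH[d] (f '' S) := by
  rcases S.eq_empty_or_nonempty with rfl | ⟨x₀, hx₀⟩
  · simp
  have : Nonempty X := ⟨x₀⟩
  have hinj : InjOn f S := fun x hx y hy hxy => by
    have := h x hx y hy
    rw [hxy, dist_self, mul_zero] at this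
    exact dist_le_zero.1 this
  have hL : LipschitzOnWith K (Function.invFunOn f S) (f '' S) := by
    refine LipschitzOnWith.of_dist_le_mul ?_
    rintro _ ⟨x, hx, rfl⟩ _ ⟨y, hy, rfl⟩
    rw [hinj.leftInvOn_invFunOn hx, hinj.leftInvOn_invFunOn hy]
    exact h x hx y hy
  have := hL.hausdorffMeasure_image_le hd
  rwa [(hinj.leftInvOn_invFunOn).image_image] at this

/-- Short arcs of a straight loop are hardly longer than their chords, as they are graphs of small
slope over them. -/
lemma Straight.sub_le_dist {γ : ℝ → E3} (hγ : IsUnitLoop γ) (hs : IsSimpleLoop γ)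
    {r : ℝ} (hS : Straight (range γ) (1 / 100) r) {s t : ℝ} (hst : s ≤ t) (htr : t - s ≤ r) :
    99 / 100 * (t - s) ≤ dist (γ s) (γ t) := by
  rcases hst.eq_or_lt with rfl | hst
  · simp
  have hr := hS.lt_one hγ hs (by norm_num)
  set e := dir (γ s) (γ t) with he
  have hne : ∀ a b, s ≤ a → a < b → b ≤ t → γ b ≠ γ a := fun a b h1 h2 h3 =>
    hs.ne hγ h2 (by linarith)
  have he1 : ‖e‖ = 1 := norm_dir (hne s t le_rfl hst le_rfl)
  have key : ∀ a b, s ≤ a → a ≤ b → b ≤ t →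
      99 / 100 * dist (γ a) (γ b) ≤ inner ℝ e (γ b) - inner ℝ e (γ a) := fun a b h1 h2 h3 => by
    rcases h2.eq_or_lt with rfl | h2
    · simp
    have hn := hS.norm_dir_sub_dir_window hγ hs (by norm_num) h1 h2 h3 htr
    rw [← inner_sub_right, ← dist_smul_dir, inner_smul_right,
      inner_eq_of_norm_one he1 (norm_dir (hne a b h1 h2 h3)), norm_sub_rev, mul_comm]
    refine mul_le_mul_of_nonneg_left ?_ dist_nonneg
    have : ‖dir (γ a) (γ b) - e‖ ^ 2 ≤ (2 * (1 / 100)) ^ 2 := by gcongr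
    linarith
  have hM := hausdorffMeasure_le_of_dist_le (f := fun q : E3 => inner ℝ e q) (S := γ '' Icc s t)
    (K := 100 / 99) (d := 1) (by
      rintro _ ⟨a, ha, rfl⟩ _ ⟨b, hb, rfl⟩
      push_cast
      rw [Real.dist_eq]
      rcases le_total a b with h | h
      · have := key a b ha.1 h hb.2
        have := neg_abs_le ((inner ℝ e (γ a) : ℝ) - inner ℝ e (γ b))
        linarith
      · have := key b a hb.1 h ha.2
        have := le_abs_self ((inner ℝ e (γ a) : ℝ) - inner ℝ e (γ b))
        rw [dist_comm]
        linarith) zero_le_one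
  have hsub : (fun q : E3 => (inner ℝ e q : ℝ)) '' (γ '' Icc s t) ⊆
      Icc (inner ℝ e (γ s)) (inner ℝ e (γ t)) := by
    rintro _ ⟨_, ⟨a, ha, rfl⟩, rfl⟩
    have h1 := key s a le_rfl ha.1 ha.2
    have h2 := key a t ha.1 ha.2 le_rfl
    constructor
    · dsimp only; linarith [dist_nonneg (x := γ s) (y := γ a)]
    · dsimp only; linarith [dist_nonneg (x := γ a) (y := γ t)]
  have hlen : (inner ℝ e (γ t) : ℝ) - inner ℝ e (γ s) = dist (γ s) (γ t) := by
    rw [← inner_sub_right, ← dist_smul_dir, inner_smul_right, real_inner_self_eq_norm_sq, he1]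
    simp
  have hM2 := ((hγ.le_measure_image (by linarith : t ≤ s + 1)).trans hM).trans
    (mul_le_mul_right (measure_mono hsub) _)
  rw [hausdorffMeasure_real, Real.volume_Icc, hlen, ENNReal.rpow_one,
    ← ENNReal.ofReal_coe_nnreal, ← ENNReal.ofReal_mul (by positivity),
    ENNReal.ofReal_le_ofReal_iff (by positivity)] at hM2
  push_cast at hM2
  linarith

/-- In a straight set no isosceles triangle has a small angle at its apex, for its other two
angles would be nearly right. -/
lemma Straight.eq_of_dist_eq {V : Type*} [NormedAddCommGroup V] [InnerProductSpace ℝ V]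
    {Γ : Set V} {ε r : ℝ} (hS : Straight Γ ε r) (hε : ε ≤ 1 / 4) {x y z : V} (hx : x ∈ Γ)
    (hy : y ∈ Γ) (hz : z ∈ Γ) (hyx : y ≠ x) (hd : dist x z = dist x y) (hr : dist x y ≤ r / 2)
    (hdir : ‖dir x y - dir x z‖ ≤ 1 / 4) : z = y := by
  by_contra hzy
  have hpos : 0 < dist x y := dist_pos.2 hyx.symm
  have hyz : dist y z = dist x y * ‖dir x y - dir x z‖ := by
    have h1 := dist_smul_dir x y
    have h2 := dist_smul_dir x z
    rw [hd] at h2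
    rw [dist_eq_norm, show y - z = (y - x) - (z - x) by abel, ← h1, ← h2, ← smul_sub, norm_smul,
      Real.norm_of_nonneg hpos.le]
  have hyz0 : 0 < dist y z := dist_pos.2 (Ne.symm hzy)
  have hle : dist y z ≤ dist x y / 4 := by rw [hyz]; nlinarith
  have hin : inner ℝ (x - y) (z - y) = dist y z ^ 2 / 2 := by
    have h := norm_sub_sq_real (x - y) (z - y)
    rw [show x - y - (z - y) = x - z by abel, ← dist_eq_norm, ← dist_eq_norm, ← dist_eq_norm, hd,
      dist_comm z y] at h
    linarith
  rw [← dist_smul_dir, ← dist_smul_dir, inner_smul_left, inner_smul_right, dist_comm y x] at hin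
  simp only [conj_trivial] at hin
  have hin2 : dist x y * inner ℝ (dir y x) (dir y z) = dist y z / 2 := by
    field_simp
    nlinarith
  have hi0 : 0 ≤ inner ℝ (dir y x) (dir y z) := by
    by_contra! h
    nlinarith
  have hi1 : inner ℝ (dir y x) (dir y z) ≤ 1 / 8 := by
    by_contra! h
    nlinarith
  have hn1 := norm_dir (x := y) (y := x) hyx.symm
  have hn2 := norm_dir (x := y) (y := z) hzy
  rcases hS y hy x hx z hz hyx.symm hzy (by rw [dist_comm]; linarith) (by linarith) with h | h
  · rw [inner_eq_of_norm_one hn1 hn2] at hi1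
    nlinarith [norm_nonneg (dir y x - dir y z)]
  · have h3 : inner ℝ (dir y x) (-dir y z) = 1 - ‖dir y x - -dir y z‖ ^ 2 / 2 :=
      inner_eq_of_norm_one hn1 (by rwa [norm_neg])
    rw [inner_neg_right, sub_neg_eq_add] at h3
    nlinarith [norm_nonneg (dir y x + dir y z)]

/-- Points of a straight loop that are close in space are close along the loop. -/
lemma Straight.exists_int_abs_le {γ : ℝ → E3} (hγ : IsUnitLoop γ) (hs : IsSimpleLoop γ)
    {r : ℝ} (hS : Straight (range γ) (1 / 100) r) {s t : ℝ} (h : dist (γ s) (γ t) ≤ r / 4) :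
    ∃ m : ℤ, |t + m - s| ≤ 2 * dist (γ s) (γ t) := by
  by_cases hst : γ s = γ t
  · obtain ⟨m, hm⟩ := hs.exists_int_of_eq hγ hst
    exact ⟨m, by rw [hm, hst]; simp⟩
  have hc := hγ.lipschitz.continuous
  have hd0 : 0 < dist (γ s) (γ t) := dist_pos.2 hst
  have hr := hS.lt_one hγ hs (by norm_num)
  have hf : Continuous fun τ => dist (γ s) (γ τ) := continuous_const.dist hc
  obtain ⟨a, ha, had⟩ := intermediate_value_Icc (show s ≤ s + r / 2 by linarith) hf.continuousOn
    (show dist (γ s) (γ t) ∈ Icc _ _ from ⟨by simp, by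
      have := hS.sub_le_dist hγ hs (show s ≤ s + r / 2 by linarith) (by linarith)
      linarith⟩)
  obtain ⟨b, hb, hbd⟩ := intermediate_value_Icc' (show s - r / 2 ≤ s by linarith) hf.continuousOn
    (show dist (γ s) (γ t) ∈ Icc _ _ from ⟨by simp, by
      have := hS.sub_le_dist hγ hs (show s - r / 2 ≤ s by linarith) (by linarith)
      linarith [dist_comm (γ s) (γ (s - r / 2))]⟩)
  dsimp only at had hbd
  have hsa : s < a := ha.1.lt_of_ne fun h => by simp [← h] at had; exact hst had
  have hbs : b < s := hb.2.lt_of_ne fun h => by simp [h] at hbd; exact hst hbd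
  have hts : γ t ≠ γ s := fun h => hst h.symm
  have hna : γ a ≠ γ s := hs.ne hγ hsa (by linarith [ha.2])
  -- The two points of the window around `s` at the same distance are in opposite directions.
  have h1 := hS.norm_dir_sub_dir_window hγ hs (by norm_num) hbs.le hsa le_rfl
    (by linarith [ha.2, hb.1] : a - b ≤ r)
  have h2 := hS.norm_dir_sub_dir_window hγ hs (by norm_num) le_rfl hbs hsa.le
    (by linarith [ha.2, hb.1] : a - b ≤ r)
  rw [dir_swap (γ s)] at h2
  have h12 : ‖dir (γ s) (γ a) + dir (γ s) (γ b)‖ ≤ 2 * (1 / 100) + 2 * (1 / 100) := by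
    refine le_trans (le_of_eq ?_) ((norm_sub_le _ _).trans (add_le_add h1 h2))
    congr 1; abel
  have main : ∃ σ, γ t = γ σ ∧ |σ - s| ≤ 2 * dist (γ s) (γ t) := by
    rcases hS _ ⟨s, rfl⟩ _ ⟨t, rfl⟩ _ ⟨a, rfl⟩ hts hna (by linarith) (by linarith) with h3 | h3
    · refine ⟨a, (hS.eq_of_dist_eq (by norm_num) ⟨s, rfl⟩ ⟨t, rfl⟩ ⟨a, rfl⟩ hts had
        (by linarith) (by linarith)).symm, ?_⟩
      rw [abs_of_pos (by linarith)]
      linarith [hS.sub_le_dist hγ hs hsa.le (by linarith [ha.2])]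
    · have h4 : ‖dir (γ s) (γ t) - dir (γ s) (γ b)‖ ≤ 1 / 4 := by
        have : dir (γ s) (γ t) - dir (γ s) (γ b) = (dir (γ s) (γ t) + dir (γ s) (γ a)) -
          (dir (γ s) (γ a) + dir (γ s) (γ b)) := by abel
        rw [this]
        linarith [norm_sub_le (dir (γ s) (γ t) + dir (γ s) (γ a))
          (dir (γ s) (γ a) + dir (γ s) (γ b))]
      refine ⟨b, (hS.eq_of_dist_eq (by norm_num) ⟨s, rfl⟩ ⟨t, rfl⟩ ⟨b, rfl⟩ hts hbd
        (by linarith) h4).symm, ?_⟩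
      rw [abs_of_neg (by linarith), ← hbd, dist_comm]
      linarith [hS.sub_le_dist hγ hs hbs.le (by linarith [hb.1])]
  obtain ⟨σ, hσ, hσs⟩ := main
  obtain ⟨m, hm⟩ := hs.exists_int_of_eq hγ hσ.symm
  exact ⟨m, by rwa [hm]⟩

lemma Straight.sub_le_two_mul_dist {γ : ℝ → E3} (hγ : IsUnitLoop γ) (hs : IsSimpleLoop γ)
    {r : ℝ} (hS : Straight (range γ) (1 / 100) r) {s t : ℝ} (hst : s < t) (hts : t - s ≤ 1 / 2)
    (h : dist (γ s) (γ t) < r / 4) : t - s ≤ 2 * dist (γ s) (γ t) := by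
  have hr := hS.lt_one hγ hs (by norm_num)
  obtain ⟨m, hm⟩ := hS.exists_int_abs_le hγ hs h.le
  have hm' := abs_le.1 hm
  rcases lt_trichotomy m 0 with h0 | h0 | h0
  · have : (m : ℝ) ≤ -1 := by exact_mod_cast (by omega : m ≤ -1)
    linarith [hm'.1]
  · rw [h0] at hm'; push_cast at hm'; linarith [hm'.2]
  · have : (1 : ℝ) ≤ m := by exact_mod_cast (by omega : 1 ≤ m)
    linarith [hm'.2]

/-! ### Displacement from the loop to the polygon -/

/-- The vector from the point on the chord from `γ s` to `γ t` that corresponds to the parameter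
`τ` to the point `γ τ`. The chord is parametrized affinely by the interval `[s, t]`. -/
noncomputable def chordGap (γ : ℝ → E3) (s t τ : ℝ) : E3 :=
  γ τ - (γ s + ((τ - s) / (t - s)) • (γ t - γ s))

lemma chordGap_left (γ : ℝ → E3) (s t : ℝ) : chordGap γ s t s = 0 := by simp [chordGap]

lemma chordGap_right (γ : ℝ → E3) {s t : ℝ} (h : s < t) : chordGap γ s t t = 0 := by
  rw [chordGap, div_self (by linarith), one_smul]; abel

lemma Straight.norm_chordGap_sub_le {γ : ℝ → E3} (hγ : IsUnitLoop γ) (hs : IsSimpleLoop γ)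
    {r : ℝ} (hS : Straight (range γ) (1 / 100) r) {s t : ℝ} (hst : s < t) (hts : t - s ≤ r)
    {a b : ℝ} (ha : s ≤ a) (hab : a ≤ b) (hb : b ≤ t) :
    ‖chordGap γ s t b - chordGap γ s t a‖ ≤ 4 / 100 * (b - a) := by
  rcases hab.eq_or_lt with rfl | hab
  · simp
  have hr := hS.lt_one hγ hs (by norm_num)
  set e := dir (γ s) (γ t) with he
  set u := dir (γ a) (γ b) with hu
  have he1 : ‖e‖ = 1 := norm_dir (hs.ne hγ hst (by linarith))
  have hue : ‖u - e‖ ≤ 2 * (1 / 100) := hS.norm_dir_sub_dir_window hγ hs (by norm_num) ha hab hb hts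
  have h1 := dist_smul_dir (γ a) (γ b)
  have h2 := dist_smul_dir (γ s) (γ t)
  rw [← hu] at h1
  rw [← he] at h2
  set l := dist (γ a) (γ b) with hl
  set L := dist (γ s) (γ t) with hL
  have hl1 : l ≤ b - a := by
    have := hγ.dist_le a b; rwa [abs_of_pos (by linarith)] at this
  have hl2 : 99 / 100 * (b - a) ≤ l := hS.sub_le_dist hγ hs hab.le (by linarith)
  have hL1 : L ≤ t - s := by
    have := hγ.dist_le s t; rwa [abs_of_pos (by linarith)] at this
  have hL2 : 99 / 100 * (t - s) ≤ L := hS.sub_le_dist hγ hs hst.le hts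
  have hdec : chordGap γ s t b - chordGap γ s t a =
      l • (u - e) + (l - (b - a)) • e + ((b - a) * (1 - L / (t - s))) • e := by
    have h3 : chordGap γ s t b - chordGap γ s t a =
        (γ b - γ a) - ((b - a) / (t - s)) • (γ t - γ s) := by
      simp only [chordGap]
      rw [show (b - a) / (t - s) = (b - s) / (t - s) - (a - s) / (t - s) by ring, sub_smul]
      abel
    rw [h3, ← h1, ← h2, smul_smul, show (b - a) / (t - s) * L = (b - a) * (L / (t - s)) by ring]
    module
  have hq1 : L / (t - s) ≤ 1 := (div_le_one (by linarith)).2 hL1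
  have hq2 : 99 / 100 ≤ L / (t - s) := (le_div_iff₀ (by linarith)).2 hL2
  have n1 : ‖l • (u - e)‖ ≤ (b - a) * (2 * (1 / 100)) := by
    rw [norm_smul, Real.norm_of_nonneg dist_nonneg]
    exact mul_le_mul hl1 hue (norm_nonneg _) (by linarith)
  have n2 : ‖(l - (b - a)) • e‖ ≤ 1 / 100 * (b - a) := by
    rw [norm_smul, he1, mul_one, Real.norm_eq_abs, abs_le]; constructor <;> linarith
  have n3 : ‖((b - a) * (1 - L / (t - s))) • e‖ ≤ 1 / 100 * (b - a) := by
    rw [norm_smul, he1, mul_one, Real.norm_of_nonneg (mul_nonneg (by linarith) (by linarith))]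
    nlinarith
  rw [hdec]
  linarith [norm_add₃_le (a := l • (u - e)) (b := (l - (b - a)) • e)
    (c := ((b - a) * (1 - L / (t - s))) • e)]

/-- The gaps over the successive chords of a cyclic partition form a Lipschitz function on the
circle of parameters, because they vanish at the vertices. -/
lemma Straight.norm_chordGap_sub_chordGap_le {γ : ℝ → E3} (hγ : IsUnitLoop γ)
    (hs : IsSimpleLoop γ) {r : ℝ} (hS : Straight (range γ) (1 / 100) r) {N : ℕ}
    {t : Fin (N + 1) → ℝ} (ht : IsCyclicPartition t)
    (htr : ∀ i : Fin N, t i.succ - t i.castSucc ≤ r) {i j : Fin N} {a b : ℝ}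
    (ha : a ∈ Icc (t i.castSucc) (t i.succ)) (hb : b ∈ Icc (t j.castSucc) (t j.succ)) (m : ℤ) :
    ‖chordGap γ (t i.castSucc) (t i.succ) a - chordGap γ (t j.castSucc) (t j.succ) b‖ ≤
      4 / 100 * |b + m - a| := by
  have hlt : ∀ k : Fin N, t k.castSucc < t k.succ := fun k => ht.1 (Fin.castSucc_lt_succ)
  have hl : ∀ (k : Fin N) {c : ℝ}, c ∈ Icc (t k.castSucc) (t k.succ) →
      ‖chordGap γ (t k.castSucc) (t k.succ) c‖ ≤ 4 / 100 * (c - t k.castSucc) := fun k c hc => by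
    have := hS.norm_chordGap_sub_le hγ hs (hlt k) (htr k) le_rfl hc.1 hc.2
    rwa [chordGap_left, sub_zero] at this
  have hr : ∀ (k : Fin N) {c : ℝ}, c ∈ Icc (t k.castSucc) (t k.succ) →
      ‖chordGap γ (t k.castSucc) (t k.succ) c‖ ≤ 4 / 100 * (t k.succ - c) := fun k c hc => by
    have := hS.norm_chordGap_sub_le hγ hs (hlt k) (htr k) hc.1 hc.2 le_rfl
    rwa [chordGap_right γ (hlt k), zero_sub, norm_neg] at this
  have hlast : ∀ k : Fin (N + 1), t k ≤ t 0 + 1 := fun k => by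
    rw [← ht.2]; exact ht.1.monotone (Fin.le_last k)
  have hzero : ∀ k : Fin (N + 1), t 0 ≤ t k := fun k => ht.1.monotone (Fin.zero_le k)
  have hn := norm_sub_le (chordGap γ (t i.castSucc) (t i.succ) a)
    (chordGap γ (t j.castSucc) (t j.succ) b)
  have tri : (i = j ∧ m = 0) ∨ t i.succ ≤ t j.castSucc + m ∨ t j.succ + m ≤ t i.castSucc := by
    rcases lt_trichotomy m 0 with h0 | h0 | h0
    · have : (m : ℝ) ≤ -1 := by exact_mod_cast (by omega : m ≤ -1)
      right; right; linarith [hlast j.succ, hzero i.castSucc]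
    · rcases lt_trichotomy i j with hij | hij | hij
      · right; left
        rw [h0]; push_cast
        rw [add_zero]
        exact ht.1.monotone (Fin.succ_le_castSucc_iff.2 hij)
      · exact Or.inl ⟨hij, h0⟩
      · right; right
        rw [h0]; push_cast
        rw [add_zero]
        exact ht.1.monotone (Fin.succ_le_castSucc_iff.2 hij)
    · have : (1 : ℝ) ≤ m := by exact_mod_cast (by omega : 1 ≤ m)
      right; left; linarith [hlast i.succ, hzero j.castSucc]
  rcases tri with ⟨rfl, rfl⟩ | h | h
  · push_cast
    rw [add_zero]
    rcases le_total a b with hab | hab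
    · rw [norm_sub_rev, abs_of_nonneg (by linarith)]
      exact hS.norm_chordGap_sub_le hγ hs (hlt i) (htr i) ha.1 hab hb.2
    · rw [abs_of_nonpos (by linarith), neg_sub]
      exact hS.norm_chordGap_sub_le hγ hs (hlt i) (htr i) hb.1 hab ha.2
  · have := le_abs_self (b + m - a)
    linarith [hr i ha, hl j hb]
  · have := neg_abs_le (b + m - a)
    linarith [hl i ha, hr j hb]

/-! ### Ambient isotopies from Lipschitz displacements -/

/-- Subtracting from the identity a contraction, scaled from `0` to `1`, is an isotopy. -/
lemma AmbientIsotopic.of_lipschitzWith {V : Type*} [NormedAddCommGroup V] [NormedSpace ℝ V]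
    [CompleteSpace V] {Ψ : V → V} {K : NNReal} (hK : K < 1) (hΨ : LipschitzWith K Ψ) (A : Set V) :
    AmbientIsotopic A ((fun x => x - Ψ x) '' A) := by
  have happ : ∀ s : unitInterval, ApproximatesLinearOn (fun x => x - (s : ℝ) • Ψ x)
      ((ContinuousLinearEquiv.refl ℝ V : V ≃L[ℝ] V) : V →L[ℝ] V) univ K := fun s x _ y _ => by
    have : x - (s : ℝ) • Ψ x - (y - (s : ℝ) • Ψ y) -
        ((ContinuousLinearEquiv.refl ℝ V : V ≃L[ℝ] V) : V →L[ℝ] V) (x - y) =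
        -((s : ℝ) • (Ψ x - Ψ y)) := by
      simp only [ContinuousLinearEquiv.coe_refl, ContinuousLinearMap.coe_id', id, smul_sub]; abel
    rw [this, norm_neg, norm_smul, Real.norm_of_nonneg s.2.1, ← dist_eq_norm, ← dist_eq_norm]
    exact (mul_le_of_le_one_left dist_nonneg s.2.2).trans (hΨ.dist_le_mul x y)
  have hc : Subsingleton V ∨
      K < ‖(((ContinuousLinearEquiv.refl ℝ V).symm : V ≃L[ℝ] V) : V →L[ℝ] V)‖₊⁻¹ := by
    rcases subsingleton_or_nontrivial V with h | h
    · exact Or.inl h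
    · right
      have : ‖(((ContinuousLinearEquiv.refl ℝ V).symm : V ≃L[ℝ] V) : V →L[ℝ] V)‖₊ = 1 := by
        ext
        simp
      rwa [this, inv_one]
  refine ⟨fun s => (happ s).toHomeomorph _ hc, ?_, fun x => ?_, ?_⟩
  · change Continuous fun q : unitInterval × V => q.2 - (q.1 : ℝ) • Ψ q.2
    have := hΨ.continuous
    fun_prop
  · change x - ((0 : unitInterval) : ℝ) • Ψ x = x
    simp
  · change (fun x => x - ((1 : unitInterval) : ℝ) • Ψ x) '' A = _
    simp

/-- Coordinatewise extension of Lipschitz maps into three-space; the factor `2` exceeds `√3`. -/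
lemma exists_lipschitzWith_extension {Γ : Set E3} {ψ : E3 → E3} {K : NNReal}
    (h : LipschitzOnWith K ψ Γ) : ∃ Ψ : E3 → E3, LipschitzWith (2 * K) Ψ ∧ EqOn ψ Ψ Γ := by
  have hi : ∀ i : Fin 3, LipschitzOnWith K (fun x => ψ x i) Γ := fun i =>
    LipschitzOnWith.of_dist_le_mul fun x hx y hy => by
      refine le_trans ?_ (h.dist_le_mul x hx y hy)
      rw [dist_eq_norm, dist_eq_norm]
      exact PiLp.norm_apply_le (ψ x - ψ y) i
  choose g hg hgE using fun i => (hi i).extend_real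
  refine ⟨fun x => WithLp.toLp 2 fun i => g i x, LipschitzWith.of_dist_le_mul fun x y => ?_,
    fun x hx => ?_⟩
  · rw [EuclideanSpace.dist_eq]
    refine Real.sqrt_le_iff.2 ⟨by positivity, ?_⟩
    rw [Fin.sum_univ_three]
    have hb : ∀ i, dist (g i x) (g i y) ^ 2 ≤ (K * dist x y) ^ 2 := fun i => by
      have := (hg i).dist_le_mul x y
      gcongr
    have h0 := hb 0
    have h1 := hb 1
    have h2 := hb 2
    push_cast
    nlinarith [sq_nonneg (K * dist x y)]
  · ext i
    exact hgE i hx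

/-- A straight loop is ambient isotopic to every inscribed polygon with short edges. -/
theorem Straight.ambientIsotopic {γ : ℝ → E3} (hγ : IsUnitLoop γ) (hs : IsSimpleLoop γ)
    {r : ℝ} (hS : Straight (range γ) (1 / 100) r) {N : ℕ} {t : Fin (N + 1) → ℝ}
    (ht : IsCyclicPartition t) (hhalf : ∀ i : Fin N, t i.succ - t i.castSucc ≤ 1 / 2)
    (hd : ∀ i : Fin N, dist (γ (t i.castSucc)) (γ (t i.succ)) < r / 16) :
    AmbientIsotopic (range γ) (inscribedPolygon γ t) := by
  have hlt : ∀ k : Fin N, t k.castSucc < t k.succ := fun k => ht.1 (Fin.castSucc_lt_succ)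
  have hr0 : ∀ i : Fin N, 0 < r := fun i => by
    linarith [hd i, dist_nonneg (x := γ (t i.castSucc)) (y := γ (t i.succ))]
  have hlen : ∀ i : Fin N, t i.succ - t i.castSucc ≤ r / 8 := fun i => by
    have := hS.sub_le_two_mul_dist hγ hs (hlt i) (hhalf i) (by linarith [hd i, hr0 i])
    linarith [hd i]
  have hlen' : ∀ i : Fin N, t i.succ - t i.castSucc ≤ r := fun i => by linarith [hlen i, hr0 i]
  have hcov : ∀ n : ℕ, ∀ h : n < N + 1, ∀ τ ∈ Ico (t 0) (t ⟨n, h⟩), ∃ i : Fin N,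
      τ ∈ Icc (t i.castSucc) (t i.succ) := fun n => by
    induction n with
    | zero => exact fun h τ hτ => absurd hτ.2 (not_lt.2 hτ.1)
    | succ n ih =>
      intro h τ hτ
      rcases lt_or_ge τ (t ⟨n, by omega⟩) with h1 | h1
      · exact ih _ τ ⟨hτ.1, h1⟩
      · exact ⟨⟨n, by omega⟩, h1, hτ.2.le⟩
  have hex : ∀ q ∈ range γ, ∃ i : Fin N, ∃ τ ∈ Icc (t i.castSucc) (t i.succ), γ τ = q := by
    rintro _ ⟨σ, rfl⟩
    obtain ⟨τ, hτ, he⟩ := hγ.periodic.exists_mem_Ico one_pos σ (t 0)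
    obtain ⟨i, hi⟩ := hcov N (by omega) τ (by rw [← ht.2] at hτ; exact hτ)
    exact ⟨i, τ, hi, he.symm⟩
  have hLip : ∀ (i j : Fin N), ∀ a ∈ Icc (t i.castSucc) (t i.succ),
      ∀ b ∈ Icc (t j.castSucc) (t j.succ),
      ‖chordGap γ (t i.castSucc) (t i.succ) a - chordGap γ (t j.castSucc) (t j.succ) b‖ ≤
        8 / 100 * dist (γ a) (γ b) := fun i j a ha b hb => by
    rcases le_or_gt (dist (γ a) (γ b)) (r / 4) with h | h
    · obtain ⟨m, hm⟩ := hS.exists_int_abs_le hγ hs h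
      linarith [hS.norm_chordGap_sub_chordGap_le hγ hs ht hlen' ha hb m]
    · have h1 := hS.norm_chordGap_sub_le hγ hs (hlt i) (hlen' i) le_rfl ha.1 ha.2
      have h2 := hS.norm_chordGap_sub_le hγ hs (hlt j) (hlen' j) le_rfl hb.1 hb.2
      rw [chordGap_left, sub_zero] at h1 h2
      have := norm_sub_le (chordGap γ (t i.castSucc) (t i.succ) a)
        (chordGap γ (t j.castSucc) (t j.succ) b)
      linarith [hlen i, hlen j, ha.2, hb.2, hr0 i]
  have : Nonempty (Fin N) := ⟨(hex _ ⟨0, rfl⟩).choose⟩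
  choose! I T hT hTq using hex
  set ψ : E3 → E3 := fun q => chordGap γ (t (I q).castSucc) (t (I q).succ) (T q) with hψ
  have hψL : LipschitzOnWith (8 / 100) ψ (range γ) :=
    LipschitzOnWith.of_dist_le_mul fun x hx y hy => by
      have := hLip (I x) (I y) (T x) (hT x hx) (T y) (hT y hy)
      rw [hTq x hx, hTq y hy, ← dist_eq_norm] at this
      simpa using this
  have hψe : ∀ i : Fin N, ∀ a ∈ Icc (t i.castSucc) (t i.succ),
      ψ (γ a) = chordGap γ (t i.castSucc) (t i.succ) a := fun i a ha => by
    have := hLip (I (γ a)) i (T (γ a)) (hT _ ⟨a, rfl⟩) a ha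
    rw [hTq _ ⟨a, rfl⟩, dist_self, mul_zero] at this
    exact sub_eq_zero.1 (norm_le_zero_iff.1 this)
  obtain ⟨Ψ, hΨL, hΨ⟩ := exists_lipschitzWith_extension hψL
  have hmove : ∀ i : Fin N, ∀ a ∈ Icc (t i.castSucc) (t i.succ), γ a - Ψ (γ a) =
      γ (t i.castSucc) + ((a - t i.castSucc) / (t i.succ - t i.castSucc)) •
        (γ (t i.succ) - γ (t i.castSucc)) := fun i a ha => by
    rw [← hΨ ⟨a, rfl⟩, hψe i a ha, chordGap]; abel
  have himg : (fun x => x - Ψ x) '' range γ = inscribedPolygon γ t := by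
    refine Subset.antisymm ?_ ?_
    · rintro _ ⟨q, hq, rfl⟩
      refine mem_iUnion.2 ⟨I q, ?_⟩
      have ha := hT q hq
      have := hmove (I q) (T q) ha
      rw [hTq q hq] at this
      dsimp only
      rw [this, segment_eq_image']
      exact ⟨_, ⟨div_nonneg (by linarith [ha.1]) (by linarith [hlt (I q)]),
        (div_le_one (by linarith [hlt (I q)])).2 (by linarith [ha.2])⟩, rfl⟩
    · refine iUnion_subset fun i => ?_
      rw [segment_eq_image']
      rintro _ ⟨θ, hθ, rfl⟩
      have h0 : 0 < t i.succ - t i.castSucc := by linarith [hlt i]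
      refine ⟨_, ⟨t i.castSucc + θ * (t i.succ - t i.castSucc), rfl⟩, ?_⟩
      dsimp only
      rw [hmove i _ ⟨by nlinarith [hθ.1], by nlinarith [hθ.2]⟩, add_sub_cancel_left,
        mul_div_assoc, div_self h0.ne', mul_one]
  rw [← himg]
  refine AmbientIsotopic.of_lipschitzWith ?_ hΨL _
  rw [← NNReal.coe_lt_coe]; push_cast; norm_num

/-! ### Straightness from flatness at all scales -/

lemma near_up_to_sign_trans {V : Type*} [NormedAddCommGroup V] {u v w : V} {a b : ℝ} (h : ‖u - v‖ ≤ a ∨ ‖u + v‖ ≤ a)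
    (h' : ‖v - w‖ ≤ b ∨ ‖v + w‖ ≤ b) : ‖u - w‖ ≤ a + b ∨ ‖u + w‖ ≤ a + b := by
  rcases h with h | h <;> rcases h' with h' | h'
  · left; rw [show u - w = (u - v) + (v - w) by abel]
    exact (norm_add_le _ _).trans (add_le_add h h')
  · right; rw [show u + w = (u - v) + (v + w) by abel]
    exact (norm_add_le _ _).trans (add_le_add h h')
  · right; rw [show u + w = (u + v) - (v - w) by abel]
    exact (norm_sub_le _ _).trans (add_le_add h h')
  · left; rw [show u - w = (u + v) - (v + w) by abel]
    exact (norm_sub_le _ _).trans (add_le_add h h')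

section Flat

variable {V : Type*} [NormedAddCommGroup V] [InnerProductSpace ℝ V]

/-- If `z` is close to the line through `x` and `y`, then it is seen from `x` along that line. The
distance from the line enters through its lower bounds `h`. -/
lemma dir_near_of_flat {x y z : V} (hyx : y ≠ x) (hzx : z ≠ x) {η : ℝ}
    (h : ∀ h : ℝ, (∀ τ : ℝ, h ≤ ‖z - x - τ • (y - x)‖) → h ≤ η * dist x z) :
    ‖dir x y - dir x z‖ ≤ 2 * η ∨ ‖dir x y + dir x z‖ ≤ 2 * η := by
  have hu := norm_dir hyx
  have hv := norm_dir hzx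
  have hD : 0 < dist x z := dist_pos.2 hzx.symm
  have ey := dist_smul_dir x y
  have ez := dist_smul_dir x z
  set u := dir x y
  set v := dir x z
  set c : ℝ := inner ℝ u v with hc
  have hw : ‖v - c • u‖ ^ 2 = 1 - c ^ 2 := by
    rw [norm_sub_sq_real, inner_smul_right, real_inner_comm, ← hc, norm_smul, hu, hv,
      mul_one, Real.norm_eq_abs, sq_abs]; ring
  have h1 : dist x z * ‖v - c • u‖ ≤ η * dist x z := by
    refine h _ fun τ => ?_
    refine (sq_le_sq₀ (by positivity) (norm_nonneg _)).1 ?_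
    rw [mul_pow, hw, ← ey, ← ez, smul_smul, norm_sub_sq_real, inner_smul_right, inner_smul_left,
      real_inner_comm, ← hc, norm_smul, norm_smul, hu, hv, mul_one, mul_one, Real.norm_eq_abs,
      Real.norm_eq_abs, sq_abs, sq_abs]
    simp only [conj_trivial]
    nlinarith [sq_nonneg (dist x z * c - τ * dist x y)]
  have h2 : ‖v - c • u‖ ≤ η := by
    rw [mul_comm] at h1; exact le_of_mul_le_mul_right h1 hD
  have h3 : 1 - c ^ 2 ≤ η ^ 2 := by
    rw [← hw]; gcongr
  have hη : 0 ≤ η := (norm_nonneg _).trans h2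
  have hc1 : |c| ≤ 1 := by
    have := abs_real_inner_le_norm u v
    rwa [hu, hv, one_mul] at this
  rcases le_total 0 c with h0 | h0
  · left
    rw [abs_of_nonneg h0] at hc1
    refine (sq_le_sq₀ (norm_nonneg _) (by positivity)).1 ?_
    rw [norm_sub_sq_real, hu, hv, ← hc]
    nlinarith
  · right
    rw [abs_of_nonpos h0] at hc1
    refine (sq_le_sq₀ (norm_nonneg _) (by positivity)).1 ?_
    rw [norm_add_sq_real, hu, hv, ← hc]
    nlinarith

/-- If the flatness of a connected set at scale `d` is `A d ^ κ`, then it is straight: the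
directions from a point to others at distances `d, 2d, 4d, …` change by amounts that sum up to a
geometric series. -/
lemma straight_of_flat {Γ : Set V} (hΓ : IsPreconnected Γ) {A κ : ℝ} (hA : 0 ≤ A) (hκ : 0 < κ)
    (hflat : ∀ x ∈ Γ, ∀ y ∈ Γ, ∀ z ∈ Γ, y ≠ x → dist x y ≤ dist x z → dist x z ≤ 2 * dist x y →
      ∀ h : ℝ, (∀ τ : ℝ, h ≤ ‖z - x - τ • (y - x)‖) → h ≤ A * dist x z ^ κ * dist x z) {r : ℝ} :
    Straight Γ (2 * A / (1 - 2 ^ (-κ)) * r ^ κ) r := by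
  have h2κ : (2 : ℝ) ^ (-κ) < 1 := Real.rpow_lt_one_of_one_lt_of_neg one_lt_two (by linarith)
  set B := 2 * A / (1 - (2 : ℝ) ^ (-κ)) with hB
  have hB0 : 0 ≤ B := div_nonneg (by linarith) (by linarith)
  have hBe : 2 * A = B - B * (2 : ℝ) ^ (-κ) := by
    rw [hB]; field_simp [show 1 - (2 : ℝ) ^ (-κ) ≠ 0 by linarith]
  have base : ∀ x ∈ Γ, ∀ y ∈ Γ, ∀ z ∈ Γ, y ≠ x → dist x y ≤ dist x z →
      dist x z ≤ 2 * dist x y → ‖dir x y - dir x z‖ ≤ 2 * (A * dist x z ^ κ) ∨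
        ‖dir x y + dir x z‖ ≤ 2 * (A * dist x z ^ κ) := fun x hx y hy z hz hyx h1 h2 => by
    refine dir_near_of_flat hyx ?_ (hflat x hx y hy z hz hyx h1 h2)
    rintro rfl
    rw [dist_self] at h1
    exact hyx (dist_le_zero.1 h1).symm
  have base' : ∀ d : ℝ, 0 ≤ d → 2 * (A * d ^ κ) ≤ B * d ^ κ := fun d hd => by
    have h1 : 0 ≤ d ^ κ := Real.rpow_nonneg hd κ
    have h2 : 0 ≤ B * (2 : ℝ) ^ (-κ) := by positivity
    nlinarith
  have main : ∀ n : ℕ, ∀ x ∈ Γ, ∀ y ∈ Γ, ∀ z ∈ Γ, y ≠ x → dist x y ≤ dist x z →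
      dist x z ≤ 2 ^ n * dist x y → ‖dir x y - dir x z‖ ≤ B * dist x z ^ κ ∨
        ‖dir x y + dir x z‖ ≤ B * dist x z ^ κ := fun n => by
    induction n with
    | zero =>
      intro x hx y hy z hz hyx h1 h2
      have hb := base' (dist x z) dist_nonneg
      exact (base x hx y hy z hz hyx h1 (by
        rw [pow_zero, one_mul] at h2; linarith [dist_nonneg (x := x) (y := y)])).imp
        (fun h => h.trans hb) (fun h => h.trans hb)
    | succ n ih =>
      intro x hx y hy z hz hyx h1 h2
      rcases le_or_gt (dist x z) (2 * dist x y) with h3 | h3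
      · have hb := base' (dist x z) dist_nonneg
        exact (base x hx y hy z hz hyx h1 h3).imp (fun h => h.trans hb) (fun h => h.trans hb)
      · obtain ⟨w, hw, hxw⟩ := hΓ.intermediate_value hy hz
          (f := fun q => dist x q) (by fun_prop)
          (show dist x z / 2 ∈ Icc _ _ from ⟨by linarith, by linarith [dist_nonneg (x := x) (y := z)]⟩)
        dsimp only at hxw
        have hpos : 0 < dist x y := dist_pos.2 hyx.symm
        have hwx : w ≠ x := by
          rintro rfl; rw [dist_self] at hxw; linarith
        have i1 := ih x hx y hy w hw hyx (by linarith) (by rw [hxw]; rw [pow_succ] at h2; linarith)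
        have i2 := base x hx w hw z hz hwx (by linarith) (by linarith)
        have e : B * dist x w ^ κ + 2 * (A * dist x z ^ κ) = B * dist x z ^ κ := by
          rw [hxw, div_eq_mul_inv, Real.mul_rpow dist_nonneg (by norm_num), ← Real.rpow_neg_one,
            ← Real.rpow_mul (by norm_num), neg_one_mul]
          linear_combination (dist x z ^ κ) * hBe
        rw [← e]
        exact near_up_to_sign_trans i1 i2
  intro x hx y hy z hz hyx hzx hyr hzr
  wlog hyz : dist x y ≤ dist x z generalizing y z
  · refine (this z hz y hy hzx hyx hzr hyr (by linarith)).imp (fun h => ?_) (fun h => ?_)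
    · rwa [norm_sub_rev]
    · rwa [add_comm]
  have hpos : 0 < dist x y := dist_pos.2 hyx.symm
  obtain ⟨n, hn⟩ := pow_unbounded_of_one_lt (dist x z / dist x y) (one_lt_two (α := ℝ))
  have hm := main n x hx y hy z hz hyx hyz ((div_le_iff₀ hpos).1 hn.le)
  have hle : B * dist x z ^ κ ≤ B * r ^ κ := by gcongr
  exact hm.imp (fun h => h.trans hle) (fun h => h.trans hle)

/-! ### Thick triangles -/

/-- A triangle stays thick if its vertices are moved by a small fraction of its height. -/
lemma half_le_norm_of_dist_le {x y z x' y' z' : V} {h ρ : ℝ}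
    (hxy : dist x y ≤ dist x z) (hxz : dist x z ≤ 2 * dist x y)
    (H : ∀ τ : ℝ, h ≤ ‖z - x - τ • (y - x)‖) (hρ : ρ ≤ h / 24)
    (hx' : dist x' x ≤ ρ) (hy' : dist y' y ≤ ρ) (hz' : dist z' z ≤ ρ) (τ : ℝ) :
    h / 2 ≤ ‖z' - x' - τ • (y' - x')‖ := by
  have h0 := H 0
  rw [zero_smul, sub_zero, ← dist_eq_norm, dist_comm] at h0
  rw [dist_eq_norm] at hx' hy' hz' hxy hxz
  have hρ0 : 0 ≤ ρ := (norm_nonneg _).trans hx'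
  rw [dist_eq_norm] at hxy hxz h0
  rcases le_or_gt |τ| 5 with h5 | h5
  · have e : z - x - τ • (y - x) = (z' - x' - τ • (y' - x')) + ((x' - x) - (z' - z)) +
        τ • ((y' - y) - (x' - x)) := by module
    have n1 : ‖τ • ((y' - y) - (x' - x))‖ ≤ 5 * (ρ + ρ) := by
      rw [norm_smul, Real.norm_eq_abs]
      exact mul_le_mul h5 ((norm_sub_le _ _).trans (add_le_add hy' hx')) (norm_nonneg _) (by norm_num)
    have n2 := (norm_sub_le (x' - x) (z' - z)).trans (add_le_add hx' hz')
    have n3 := H τ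
    rw [e] at n3
    linarith [norm_add₃_le (a := z' - x' - τ • (y' - x')) (b := (x' - x) - (z' - z))
      (c := τ • ((y' - y) - (x' - x)))]
  · have n1 : ‖x - y‖ - (ρ + ρ) ≤ ‖y' - x'‖ := by
      have : x - y = (x' - y') + ((y' - y) - (x' - x)) := by abel
      have h1 := norm_add_le (x' - y') ((y' - y) - (x' - x))
      rw [← this, norm_sub_rev x' y'] at h1
      linarith [(norm_sub_le (y' - y) (x' - x)).trans (add_le_add hy' hx')]
    have n2 : ‖z' - x'‖ ≤ ‖x - z‖ + (ρ + ρ) := by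
      have : z' - x' = (z - x) + ((z' - z) - (x' - x)) := by abel
      rw [this]
      refine (norm_add_le _ _).trans (add_le_add (norm_sub_rev _ _).le ?_)
      exact (norm_sub_le (z' - z) (x' - x)).trans (add_le_add hz' hx')
    have n3 : 5 * ‖y' - x'‖ ≤ ‖τ • (y' - x')‖ := by
      rw [norm_smul, Real.norm_eq_abs]
      exact mul_le_mul_of_nonneg_right h5.le (norm_nonneg _)
    have n4 := norm_sub_norm_le (τ • (y' - x')) (z' - x')
    rw [norm_sub_rev (τ • (y' - x'))] at n4
    linarith

end Flat

/-- By the law of sines: `h` is a lower bound for the height of the triangle over the side `xy`. -/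
lemma circleRadius_le {x y z : E3} {h : ℝ} (h0 : 0 < h) (hxy : x ≠ y)
    (H : ∀ τ : ℝ, h ≤ ‖z - x - τ • (y - x)‖) :
    circleRadius x y z ≤ ENNReal.ofReal (dist y z * dist x z / (2 * h)) := by
  have hnc : ¬ Collinear ℝ ({x, y, z} : Set E3) := fun hc => by
    obtain ⟨v, hv⟩ := (collinear_iff_of_mem (p₀ := x) (by simp)).1 hc
    obtain ⟨a, ha⟩ := hv y (by simp)
    obtain ⟨b, hb⟩ := hv z (by simp)
    have ha0 : a ≠ 0 := fun h => hxy (by rw [ha, h]; simp)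
    have := H (b / a)
    rw [ha, hb] at this
    simp only [vadd_eq_add, add_sub_cancel_right, smul_smul, div_mul_cancel₀ _ ha0, sub_self,
      norm_zero] at this
    linarith
  have hind : AffineIndependent ℝ ![x, y, z] := affineIndependent_iff_not_collinear_set.2 hnc
  rw [circleRadius, dif_pos hind]
  refine ENNReal.ofReal_le_ofReal ?_
  set T : Affine.Triangle ℝ E3 := ⟨![x, y, z], hind⟩ with hT
  have hR := T.dist_div_sin_angle_div_two_eq_circumradius (i₁ := 1) (i₂ := 0) (i₃ := 2)
    (by decide) (by decide) (by decide)
  have e0 : T.points 0 = x := rfl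
  have e1 : T.points 1 = y := rfl
  have e2 : T.points 2 = z := rfl
  rw [e0, e1, e2] at hR
  rw [← hR]
  have hu : 0 < ‖y - x‖ := norm_pos_iff.2 (sub_ne_zero.2 hxy.symm)
  have hs : h ≤ Real.sin (EuclideanGeometry.angle y x z) * dist x z := by
    have hs1 := InnerProductGeometry.sin_angle_mul_norm_mul_norm (y - x) (z - x)
    have hs2 : h * ‖y - x‖ ≤ Real.sin (InnerProductGeometry.angle (y - x) (z - x)) *
        (‖y - x‖ * ‖z - x‖) := by
      rw [hs1]
      refine Real.le_sqrt_of_sq_le ?_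
      have h1 := H (inner ℝ (y - x) (z - x) / ‖y - x‖ ^ 2)
      have h2 : h ^ 2 ≤ _ := pow_le_pow_left₀ h0.le h1 2
      rw [norm_sub_sq_real, inner_smul_right, norm_smul, Real.norm_eq_abs, mul_pow, sq_abs,
        real_inner_comm (y - x)] at h2
      rw [mul_pow, real_inner_self_eq_norm_sq, real_inner_self_eq_norm_sq]
      have h3 : ‖z - x‖ ^ 2 - 2 * (inner ℝ (y - x) (z - x) / ‖y - x‖ ^ 2 *
          inner ℝ (y - x) (z - x)) + (inner ℝ (y - x) (z - x) / ‖y - x‖ ^ 2) ^ 2 * ‖y - x‖ ^ 2 =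
          (‖y - x‖ ^ 2 * ‖z - x‖ ^ 2 - inner ℝ (y - x) (z - x) * inner ℝ (y - x) (z - x)) /
            ‖y - x‖ ^ 2 := by
        field_simp; ring
      rw [h3] at h2
      exact (le_div_iff₀ (by positivity)).1 h2
    rw [dist_comm x z, dist_eq_norm]
    change h ≤ Real.sin (InnerProductGeometry.angle (y - x) (z - x)) * ‖z - x‖
    refine le_of_mul_le_mul_right ?_ hu
    linarith
  have hxz : 0 < dist x z := dist_pos.2 fun e => by
    rw [e, dist_self, mul_zero] at hs; linarith
  have hsin : 0 < Real.sin (EuclideanGeometry.angle y x z) := by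
    by_contra! hn
    nlinarith
  rw [div_div, div_le_div_iff₀ (by positivity) (by positivity)]
  have : dist y z * h ≤ dist y z * (Real.sin (EuclideanGeometry.angle y x z) * dist x z) := by
    gcongr
  nlinarith

/-! ### Lower bounds for the energies: auxiliary facts -/

lemma mul_measure_le_lintegral {α : Type*} [MeasurableSpace α] {μ : Measure α} {S : Set α}
    (hS : MeasurableSet S) {c : ℝ≥0∞} {f : α → ℝ≥0∞} (h : ∀ x ∈ S, c ≤ f x) :
    c * μ S ≤ ∫⁻ x, f x ∂μ :=
  calc c * μ S = ∫⁻ _ in S, c ∂μ := (setLIntegral_const S c).symm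
    _ ≤ ∫⁻ x in S, f x ∂μ := setLIntegral_mono' hS h
    _ ≤ ∫⁻ x, f x ∂μ := setLIntegral_le_lintegral S f

lemma mul_prod_measure_le_lintegral {α β : Type*} [MeasurableSpace α] [MeasurableSpace β]
    {μ : Measure α} {ν : Measure β} [SFinite ν] {S : Set (α × β)} (hS : MeasurableSet S)
    {c : ℝ≥0∞} {f : α → β → ℝ≥0∞} (h : ∀ x y, (x, y) ∈ S → c ≤ f x y) :
    c * (μ.prod ν) S ≤ ∫⁻ x, ∫⁻ y, f x y ∂ν ∂μ := by
  rw [Measure.prod_apply hS, ← lintegral_const_mul _ (measurable_measure_prodMk_left hS)]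
  exact lintegral_mono fun x =>
    mul_measure_le_lintegral (measurable_prodMk_left hS) fun y hy => h x y hy

lemma ofReal_le_inv_rpow {R : ℝ≥0∞} {K p : ℝ} (hK : 0 < K) (hp : 0 ≤ p)
    (h : R ≤ ENNReal.ofReal K) : ENNReal.ofReal (K⁻¹ ^ p) ≤ (R ^ p)⁻¹ := by
  rw [Real.inv_rpow hK.le, ENNReal.ofReal_inv_of_pos (Real.rpow_pos_of_pos hK p),
    ← ENNReal.ofReal_rpow_of_pos hK]
  exact ENNReal.inv_le_inv.2 (ENNReal.rpow_le_rpow h hp)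

lemma IsUnitLoop.dist_le_one {γ : ℝ → E3} (hγ : IsUnitLoop γ) {x y : E3} (hx : x ∈ range γ)
    (hy : y ∈ range γ) : dist x y ≤ 1 := by
  obtain ⟨s, rfl⟩ := hx
  obtain ⟨t, rfl⟩ := hy
  obtain ⟨u, hu, he⟩ := hγ.periodic.exists_mem_Ico one_pos t s
  rw [he]
  refine (hγ.dist_le s u).trans ?_
  rw [abs_of_nonneg (by linarith [hu.1])]
  linarith [hu.2]

lemma IsUnitLoop.le_measure_closedBall {γ : ℝ → E3} (hγ : IsUnitLoop γ) {x : E3}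
    (hx : x ∈ range γ) {ρ : ℝ} (hρ : ρ ≤ 1) :
    ENNReal.ofReal ρ ≤ (μH[1]).restrict (range γ) (Metric.closedBall x ρ) := by
  obtain ⟨s, rfl⟩ := hx
  rw [Measure.restrict_apply Metric.isClosed_closedBall.measurableSet]
  have h := hγ.le_measure_image (show s + ρ ≤ s + 1 by linarith)
  rw [add_sub_cancel_left] at h
  refine h.trans (measure_mono ?_)
  rintro _ ⟨t, ht, rfl⟩
  refine ⟨?_, t, rfl⟩
  rw [Metric.mem_closedBall, dist_comm]
  refine (hγ.dist_le s t).trans ?_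
  rw [abs_of_nonneg (by linarith [ht.1])]
  linarith [ht.2]

/-- Triangles with vertices near those of a thick triangle have a bounded circumradius. -/
lemma circleRadius_le_of_dist_le {x y z x' y' z' : E3} {h : ℝ} (h0 : 0 < h)
    (hxy : dist x y ≤ dist x z) (hxz : dist x z ≤ 2 * dist x y)
    (H : ∀ τ : ℝ, h ≤ ‖z - x - τ • (y - x)‖)
    (hx' : dist x' x ≤ h / 24) (hy' : dist y' y ≤ h / 24) (hz' : dist z' z ≤ h / 24) :
    (z' ≠ x' ∧ x' ≠ y' ∧ y' ≠ z') ∧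
      circleRadius x' y' z' ≤ ENNReal.ofReal (12 * dist x y ^ 2 / h) := by
  have H' := half_le_norm_of_dist_le hxy hxz H le_rfl hx' hy' hz'
  have hh := H 0
  rw [zero_smul, sub_zero, ← dist_eq_norm, dist_comm] at hh
  have h1 := H' 0
  have h2 := H' 1
  rw [zero_smul, sub_zero, ← dist_eq_norm] at h1
  rw [one_smul, sub_sub_sub_cancel_right, ← dist_eq_norm] at h2
  have hne : x' ≠ y' := by
    rintro rfl
    have := dist_triangle_left x y x'
    linarith
  refine ⟨⟨dist_pos.1 (by linarith), hne, (dist_pos.1 (by linarith)).symm⟩, ?_⟩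
  refine (circleRadius_le (half_pos h0) hne H').trans (ENNReal.ofReal_le_ofReal ?_)
  have t1 : dist y' z' ≤ 4 * dist x y := by
    have := dist_triangle4 y' y z z'
    have := dist_triangle_left y z x
    linarith [dist_comm z z']
  have t2 : dist x' z' ≤ 3 * dist x y := by
    have := dist_triangle4 x' x z z'
    linarith [dist_comm z z']
  rw [mul_div_cancel₀ _ two_ne_zero]
  refine div_le_div_of_nonneg_right ?_ h0.le
  calc dist y' z' * dist x' z' ≤ (4 * dist x y) * (3 * dist x y) :=
        mul_le_mul t1 t2 dist_nonneg (by positivity)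
    _ = _ := by ring

/-! ### Lower bounds for the energies of Menger type -/

section Menger

variable {γ : ℝ → E3} {x y z : E3} {h p : ℝ}

/-- If a triangle inscribed in the loop is thick, then so are all those with vertices near the
vertices of the first one, and these contribute to the energy. -/
lemma le_energy_M (hγ : IsUnitLoop γ) (hp : 0 < p) (hx : x ∈ range γ) (hy : y ∈ range γ)
    (hz : z ∈ range γ) (h0 : 0 < h) (hxy : dist x y ≤ dist x z) (hxz : dist x z ≤ 2 * dist x y)
    (H : ∀ τ : ℝ, h ≤ ‖z - x - τ • (y - x)‖) :
    ENNReal.ofReal ((12 * dist x y ^ 2 / h)⁻¹ ^ p) * ENNReal.ofReal (h / 24) ^ 3 ≤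
      CurvatureEnergy.energy p γ .M := by
  have hh := H 0
  rw [zero_smul, sub_zero, ← dist_eq_norm, dist_comm] at hh
  have hρ : h / 24 ≤ 1 := by linarith [hγ.dist_le_one hx hz]
  have hK : 0 < 12 * dist x y ^ 2 / h := by
    have : 0 < dist x y := by linarith
    positivity
  have hb : ∀ w : E3, MeasurableSet (Metric.closedBall w (h / 24)) :=
    fun w => Metric.isClosed_closedBall.measurableSet
  rw [pow_succ (ENNReal.ofReal (h / 24)), pow_two (ENNReal.ofReal (h / 24)), ← mul_assoc,
    ← mul_assoc]
  refine (mul_le_mul_right (hγ.le_measure_closedBall hx hρ) _).trans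
    (mul_measure_le_lintegral (hb x) fun x' hx' => ?_)
  refine (mul_le_mul_right (hγ.le_measure_closedBall hy hρ) _).trans
    (mul_measure_le_lintegral (hb y) fun y' hy' => ?_)
  refine (mul_le_mul_right (hγ.le_measure_closedBall hz hρ) _).trans
    (mul_measure_le_lintegral (hb z) fun z' hz' => ?_)
  exact ofReal_le_inv_rpow hK hp.le (circleRadius_le_of_dist_le h0 hxy hxz H hx' hy' hz').2

lemma le_energy_I (hγ : IsUnitLoop γ) (hp : 0 < p) (hx : x ∈ range γ) (hy : y ∈ range γ)
    (hz : z ∈ range γ) (h0 : 0 < h) (hxy : dist x y ≤ dist x z) (hxz : dist x z ≤ 2 * dist x y)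
    (H : ∀ τ : ℝ, h ≤ ‖z - x - τ • (y - x)‖) :
    ENNReal.ofReal ((12 * dist x y ^ 2 / h)⁻¹ ^ p) * ENNReal.ofReal (h / 24) ^ 2 ≤
      CurvatureEnergy.energy p γ .I := by
  have hh := H 0
  rw [zero_smul, sub_zero, ← dist_eq_norm, dist_comm] at hh
  have hρ : h / 24 ≤ 1 := by linarith [hγ.dist_le_one hx hz]
  have hK : 0 < 12 * dist x y ^ 2 / h := by
    have : 0 < dist x y := by linarith
    positivity
  have hb : ∀ w : E3, MeasurableSet (Metric.closedBall w (h / 24)) :=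
    fun w => Metric.isClosed_closedBall.measurableSet
  rw [pow_two (ENNReal.ofReal (h / 24)), ← mul_assoc]
  refine (mul_le_mul_right (hγ.le_measure_closedBall hx hρ) _).trans
    (mul_measure_le_lintegral (hb x) fun x' hx' => ?_)
  refine (mul_le_mul_right (hγ.le_measure_closedBall hy hρ) _).trans
    (mul_measure_le_lintegral (hb y) fun y' hy' => ?_)
  obtain ⟨hne, hR⟩ := circleRadius_le_of_dist_le (z' := z) h0 hxy hxz H hx' hy'
    (by rw [dist_self]; positivity)
  exact ofReal_le_inv_rpow hK hp.le
    ((iInf₂_le (f := fun z _ => circleRadius x' y' z) z ⟨hz, hne⟩).trans hR)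

lemma le_energy_U (hγ : IsUnitLoop γ) (hp : 0 < p) (hx : x ∈ range γ) (hy : y ∈ range γ)
    (hz : z ∈ range γ) (h0 : 0 < h) (hxy : dist x y ≤ dist x z) (hxz : dist x z ≤ 2 * dist x y)
    (H : ∀ τ : ℝ, h ≤ ‖z - x - τ • (y - x)‖) :
    ENNReal.ofReal ((12 * dist x y ^ 2 / h)⁻¹ ^ p) * ENNReal.ofReal (h / 24) ≤
      CurvatureEnergy.energy p γ .U := by
  have hh := H 0
  rw [zero_smul, sub_zero, ← dist_eq_norm, dist_comm] at hh
  have hρ : h / 24 ≤ 1 := by linarith [hγ.dist_le_one hx hz]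
  have hK : 0 < 12 * dist x y ^ 2 / h := by
    have : 0 < dist x y := by linarith
    positivity
  refine (mul_le_mul_right (hγ.le_measure_closedBall hx hρ) _).trans
    (mul_measure_le_lintegral Metric.isClosed_closedBall.measurableSet fun x' hx' => ?_)
  obtain ⟨hne, hR⟩ := circleRadius_le_of_dist_le (y' := y) (z' := z) h0 hxy hxz H hx'
    (by rw [dist_self]; positivity) (by rw [dist_self]; positivity)
  exact ofReal_le_inv_rpow hK hp.le
    ((iInf₂_le (f := fun y _ => radiusInf (range γ) x' y) y hy).trans
      ((iInf₂_le (f := fun z _ => circleRadius x' y z) z ⟨hz, hne⟩).trans hR))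

end Menger

/-! ### Measurability of the tangent-point condition -/

lemma IsSimpleLoop.measurable_tangentAt {γ : ℝ → E3} (hs : IsSimpleLoop γ)
    (hc : Continuous γ) : Measurable (tangentAt γ) := by
  refine (measurable_deriv γ).comp fun S hS => ?_
  set I : Set ℝ := Ico 0 1
  have hI : MeasurableSet (γ '' I) :=
    measurableSet_Ico.image_of_continuousOn_injOn hc.continuousOn hs
  have h1 : Function.invFunOn γ I ⁻¹' S ∩ γ '' I = γ '' (S ∩ I) := by
    ext q
    constructor
    · rintro ⟨h, t, ht, rfl⟩
      rw [mem_preimage, hs.leftInvOn_invFunOn ht] at h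
      exact ⟨t, ⟨h, ht⟩, rfl⟩
    · rintro ⟨t, ⟨h, ht⟩, rfl⟩
      refine ⟨?_, t, ht, rfl⟩
      rwa [mem_preimage, hs.leftInvOn_invFunOn ht]
  have h2 : MeasurableSet (Function.invFunOn γ I ⁻¹' S ∩ (γ '' I)ᶜ) := by
    -- Outside the curve `invFunOn` is constant.
    have hconst : ∀ q ∈ (γ '' I)ᶜ, Function.invFunOn γ I q = Classical.choice inferInstance :=
      fun q hq => Function.invFunOn_neg fun ⟨t, ht, he⟩ => hq ⟨t, ht, he⟩
    by_cases hS' : (Classical.choice inferInstance : ℝ) ∈ S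
    · convert hI.compl using 1
      exact inter_eq_right.2 fun q hq => by rw [mem_preimage, hconst q hq]; exact hS'
    · convert MeasurableSet.empty using 1
      refine eq_empty_of_forall_notMem fun q hq => hS' ?_
      rw [← hconst q hq.2]
      exact hq.1
  rw [← inter_union_compl (Function.invFunOn γ I ⁻¹' S) (γ '' I), h1]
  exact ((hS.inter measurableSet_Ico).image_of_continuousOn_injOn hc.continuousOn
    (hs.mono inter_subset_right)).union h2

/-- The pairs of points each of which has distance at least `e` from the tangent line at the
other one. -/
def farPairs (γ : ℝ → E3) (e : ℝ) : Set (E3 × E3) :=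
  {q | e ≤ Metric.infDist q.2 (tangentLine γ q.1) ∧ e ≤ Metric.infDist q.1 (tangentLine γ q.2)}

lemma infDist_tangentLine_lt_iff {γ : ℝ → E3} {e : ℝ} {x y : E3} :
    Metric.infDist y (tangentLine γ x) < e ↔ ∃ τ : ℝ, ‖y - x - τ • tangentAt γ x‖ < e := by
  rw [tangentLine, Metric.infDist_lt_iff (range_nonempty _)]
  simp only [exists_range_iff, dist_eq_norm, sub_sub]

lemma measurableSet_farPairs {γ : ℝ → E3} (h : Measurable (tangentAt γ)) (e : ℝ) :
    MeasurableSet (farPairs γ e) := by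
  have hopen : IsOpen {w : (E3 × E3) × E3 | ∃ τ : ℝ, ‖w.1.2 - w.1.1 - τ • w.2‖ < e} := by
    simp only [ofPred_exists]
    exact isOpen_iUnion fun τ => isOpen_lt (by fun_prop) continuous_const
  have h1 : MeasurableSet {q : E3 × E3 | Metric.infDist q.2 (tangentLine γ q.1) < e} := by
    have hm : Measurable fun q : E3 × E3 => (q, tangentAt γ q.1) :=
      measurable_id.prodMk (h.comp measurable_fst)
    convert hm hopen.measurableSet using 1
    ext q
    exact infDist_tangentLine_lt_iff
  have h2 : MeasurableSet {q : E3 × E3 | Metric.infDist q.1 (tangentLine γ q.2) < e} :=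
    measurable_swap h1
  convert h1.compl.inter h2.compl using 1
  ext q
  simp [farPairs, not_lt]

/-! ### Choice of points that avoid a small set of pairs -/

open ProbabilityTheory in
/-- If every choice of one point in each of finitely many sets contains a pair from `B`, then
for some two of these sets the pairs from `B` make up a definite part of the product. -/
lemma exists_le_measure_prod {Ω ι : Type*} [MeasurableSpace Ω] [Fintype ι] {ν : Measure Ω}
    [IsFiniteMeasure ν] {S : ι → Set Ω} (hν : ∀ i, ν (S i) ≠ 0)
    {B : Set (Ω × Ω)} (hB : MeasurableSet B)
    (h : ∀ ω : ι → Ω, (∀ i, ω i ∈ S i) → ∃ i j, i ≠ j ∧ (ω i, ω j) ∈ B) :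
    ∃ i j, ν (S i) * ν (S j) ≤ (Fintype.card ι : ℝ≥0∞) ^ 2 * (ν.prod ν) (B ∩ S i ×ˢ S j) := by
  classical
  by_contra! hcon
  have hprob : ∀ i, IsProbabilityMeasure (ν[|S i]) := fun i => cond_isProbabilityMeasure (hν i)
  set P : Measure (ι → Ω) := Measure.pi fun i => ν[|S i] with hP
  have hmap : ∀ i, P.map (fun ω => ω i) = ν[|S i] := fun i =>
    (measurePreserving_eval (fun i => ν[|S i]) i).map_eq
  have hpair : ∀ i j, i ≠ j → P {ω | (ω i, ω j) ∈ B} =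
      (ν (S i))⁻¹ * ((ν (S j))⁻¹ * (ν.prod ν) (B ∩ S i ×ˢ S j)) := fun i j hij => by
    have hind : iIndepFun (fun i (ω : ι → Ω) => ω i) P :=
      iIndepFun_pi (X := fun _ ω => ω) fun i => aemeasurable_id
    have h2 := (indepFun_iff_map_prod_eq_prod_map_map (measurable_pi_apply i).aemeasurable
      (measurable_pi_apply j).aemeasurable).1 (hind.indepFun hij)
    rw [hmap, hmap] at h2
    have hm : Measurable fun ω : ι → Ω => (ω i, ω j) :=
      (measurable_pi_apply i).prodMk (measurable_pi_apply j)
    have h3 := Measure.map_apply (μ := P) hm hB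
    rw [h2] at h3
    change P ((fun ω : ι → Ω => (ω i, ω j)) ⁻¹' B) = _
    rw [← h3, ProbabilityTheory.cond, ProbabilityTheory.cond, Measure.prod_smul_left,
      Measure.prod_smul_right, Measure.prod_restrict]
    simp only [Measure.smul_apply, smul_eq_mul, Measure.restrict_apply hB]
  have hmem : P {ω | ∀ i, ω i ∈ S i} = 1 := by
    have : {ω : ι → Ω | ∀ i, ω i ∈ S i} = univ.pi S := by ext; simp
    rw [this, hP, Measure.pi_pi]
    exact Finset.prod_eq_one fun i _ => cond_apply_self (hν i) (measure_ne_top _ _)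
  have hsub : {ω : ι → Ω | ∀ i, ω i ∈ S i} ⊆
      ⋃ q ∈ (Finset.univ : Finset (ι × ι)).filter (fun q => q.1 ≠ q.2),
        {ω | (ω q.1, ω q.2) ∈ B} := fun ω hω => by
    obtain ⟨i, j, hij, hb⟩ := h ω hω
    exact mem_iUnion₂.2 ⟨(i, j), by simpa using hij, hb⟩
  have hle := (measure_mono hsub).trans (measure_biUnion_finset_le (μ := P) _ _)
  rw [hmem] at hle
  have hne : ((Finset.univ : Finset (ι × ι)).filter (fun q => q.1 ≠ q.2)).Nonempty := by
    by_contra hemp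
    rw [Finset.not_nonempty_iff_eq_empty.1 hemp] at hle
    simp at hle
  obtain ⟨q₀, hq₀⟩ := hne
  have hcard : (Fintype.card ι : ℝ≥0∞) ^ 2 ≠ 0 := by
    have : 0 < Fintype.card ι := Fintype.card_pos_iff.2 ⟨q₀.1⟩
    exact pow_ne_zero _ (by exact_mod_cast this.ne')
  have hcard' : (Fintype.card ι : ℝ≥0∞) ^ 2 ≠ ∞ := ENNReal.pow_ne_top (ENNReal.natCast_ne_top _)
  have hlt : ∀ i j, i ≠ j → P {ω | (ω i, ω j) ∈ B} < ((Fintype.card ι : ℝ≥0∞) ^ 2)⁻¹ :=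
    fun i j hij => by
    rw [hpair i j hij, ← mul_assoc, ← ENNReal.mul_inv (Or.inl (hν i)) (Or.inr (hν j)),
      mul_comm, ← div_eq_mul_inv, ENNReal.div_lt_iff, mul_comm, ← div_eq_mul_inv,
      ENNReal.lt_div_iff_mul_lt, mul_comm]
    · exact hcon i j
    · exact Or.inl hcard
    · exact Or.inl hcard'
    · exact Or.inl (mul_ne_zero (hν i) (hν j))
    · exact Or.inl (ENNReal.mul_ne_top (measure_ne_top _ _) (measure_ne_top _ _))
  have hsum := ENNReal.sum_lt_sum_of_nonempty ⟨q₀, hq₀⟩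
    (f := fun q : ι × ι => P {ω | (ω q.1, ω q.2) ∈ B})
    (g := fun _ => ((Fintype.card ι : ℝ≥0∞) ^ 2)⁻¹)
    (fun q hq => hlt q.1 q.2 (Finset.mem_filter.1 hq).2)
  have hcnt : (((Finset.univ : Finset (ι × ι)).filter (fun q => q.1 ≠ q.2)).card : ℝ≥0∞) ≤
      (Fintype.card ι : ℝ≥0∞) ^ 2 := by
    have := Finset.card_filter_le (Finset.univ : Finset (ι × ι)) (fun q => q.1 ≠ q.2)
    rw [Finset.card_univ, Fintype.card_prod, ← pow_two] at this
    exact_mod_cast this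
  rw [Finset.sum_const, nsmul_eq_mul] at hsum
  have := hsum.trans_le (mul_le_mul_left hcnt _)
  rw [ENNReal.mul_inv_cancel hcard hcard'] at this
  exact absurd hle (not_le.2 this)

/-! ### Points near their mutual tangent lines -/

section Lines

variable {V : Type*} [NormedAddCommGroup V] [InnerProductSpace ℝ V]

/-- A point near a line is near the line through two other points near the first line, provided
these are not too close to each other. -/
lemma exists_near_line {O v a b q : V} {e D : ℝ} (he : 0 < e) (heD : 4 * e ≤ D)
    (ha : ∃ τ : ℝ, ‖a - O - τ • v‖ ≤ e) (hb : ∃ τ : ℝ, ‖b - O - τ • v‖ ≤ e)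
    (hq : ∃ τ : ℝ, ‖q - O - τ • v‖ ≤ e) (hab : D ≤ ‖b - a‖) (hqa : ‖q - a‖ ≤ 20 * D) :
    ∃ σ : ℝ, |σ| ≤ 41 ∧ ‖q - a - σ • (b - a)‖ ≤ 84 * e := by
  obtain ⟨α, hα⟩ := ha
  obtain ⟨β, hβ⟩ := hb
  obtain ⟨κ, hκ⟩ := hq
  have hw : ‖(b - a) - (β - α) • v‖ ≤ 2 * e := by
    rw [show (b - a) - (β - α) • v = (b - O - β • v) - (a - O - α • v) by module]
    linarith [norm_sub_le (b - O - β • v) (a - O - α • v)]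
  have hw' : ‖(q - a) - (κ - α) • v‖ ≤ 2 * e := by
    rw [show (q - a) - (κ - α) • v = (q - O - κ • v) - (a - O - α • v) by module]
    linarith [norm_sub_le (q - O - κ • v) (a - O - α • v)]
  have h1 : D / 2 ≤ ‖(β - α) • v‖ := by
    linarith [norm_sub_norm_le (b - a) ((β - α) • v)]
  have h2 : ‖(κ - α) • v‖ ≤ 41 * (D / 2) := by
    have := norm_sub_norm_le ((κ - α) • v) (q - a)
    rw [norm_sub_rev ((κ - α) • v)] at this
    linarith
  have hne : β - α ≠ 0 := fun h0 => by
    rw [h0, zero_smul, norm_zero] at h1; linarith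
  have hσ : ((κ - α) / (β - α)) • ((β - α) • v) = (κ - α) • v := by
    rw [smul_smul, div_mul_cancel₀ _ hne]
  have hσ1 : |(κ - α) / (β - α)| ≤ 41 := by
    have h3 : |(κ - α) / (β - α)| * ‖(β - α) • v‖ = ‖(κ - α) • v‖ := by
      rw [← hσ, norm_smul ((κ - α) / (β - α)), Real.norm_eq_abs]
    by_contra! hc
    nlinarith
  refine ⟨(κ - α) / (β - α), hσ1, ?_⟩
  set σ := (κ - α) / (β - α)
  have e1 : q - a - σ • (b - a) = ((q - a) - (κ - α) • v) - σ • ((b - a) - (β - α) • v) := by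
    rw [smul_sub σ (b - a), hσ]; abel
  have h4 : ‖σ • ((b - a) - (β - α) • v)‖ ≤ 41 * (2 * e) := by
    rw [norm_smul, Real.norm_eq_abs]
    exact mul_le_mul hσ1 hw (norm_nonneg _) (by norm_num)
  rw [e1]
  linarith [norm_sub_le ((q - a) - (κ - α) • v) (σ • ((b - a) - (β - α) • v))]

/-- Every tournament on four vertices contains a transitive triple. -/
lemma exists_transitive_triple {R : Fin 4 → Fin 4 → Prop} (h : ∀ i j, i ≠ j → R i j ∨ R j i) :
    ∃ i j k, i ≠ j ∧ i ≠ k ∧ j ≠ k ∧ R i j ∧ R i k ∧ R j k := by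
  have out : ∀ i j k, i ≠ j → i ≠ k → j ≠ k → R i j → R i k →
      ∃ i j k, i ≠ j ∧ i ≠ k ∧ j ≠ k ∧ R i j ∧ R i k ∧ R j k := fun i j k hij hik hjk h1 h2 =>
    (h j k hjk).elim (fun h3 => ⟨i, j, k, hij, hik, hjk, h1, h2, h3⟩)
      (fun h3 => ⟨i, k, j, hik, hij, hjk.symm, h2, h1, h3⟩)
  have inn : ∀ i j k, i ≠ j → i ≠ k → j ≠ k → R j i → R k i →
      ∃ i j k, i ≠ j ∧ i ≠ k ∧ j ≠ k ∧ R i j ∧ R i k ∧ R j k := fun i j k hij hik hjk h1 h2 =>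
    (h j k hjk).elim (fun h3 => ⟨j, k, i, hjk, hij.symm, hik.symm, h3, h1, h2⟩)
      (fun h3 => ⟨k, j, i, hjk.symm, hik.symm, hij.symm, h3, h2, h1⟩)
  rcases h 0 1 (by decide) with h1 | h1 <;> rcases h 0 2 (by decide) with h2 | h2
  · exact out 0 1 2 (by decide) (by decide) (by decide) h1 h2
  · rcases h 0 3 (by decide) with h3 | h3
    · exact out 0 1 3 (by decide) (by decide) (by decide) h1 h3
    · exact inn 0 2 3 (by decide) (by decide) (by decide) h2 h3
  · rcases h 0 3 (by decide) with h3 | h3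
    · exact out 0 2 3 (by decide) (by decide) (by decide) h2 h3
    · exact inn 0 1 3 (by decide) (by decide) (by decide) h1 h3
  · exact inn 0 1 2 (by decide) (by decide) (by decide) h1 h2

/-- Let lines with directions `v` be given at four separated points `ω (inl i)` and at three more
points. If of any two of these points one is near the line at the other, then the three points are
nearly collinear. -/
lemma exists_near_line_of_tournament {ω v : Fin 4 ⊕ Fin 3 → V} {e D : ℝ} (he : 0 < e)
    (heD : 20000 * e ≤ D)
    (hnear : ∀ i j, i ≠ j → (∃ τ : ℝ, ‖ω j - ω i - τ • v i‖ ≤ e) ∨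
      ∃ τ : ℝ, ‖ω i - ω j - τ • v j‖ ≤ e)
    (hsep : ∀ i j : Fin 4, i ≠ j → D ≤ ‖ω (.inl j) - ω (.inl i)‖)
    (hsep' : D ≤ ‖ω (.inr 1) - ω (.inr 0)‖) (hdiam : ∀ i j, ‖ω i - ω j‖ ≤ 20 * D) :
    ∃ σ : ℝ, ‖ω (.inr 2) - ω (.inr 0) - σ • (ω (.inr 1) - ω (.inr 0))‖ ≤ 300000 * e := by
  have self : ∀ O w : V, ∃ τ : ℝ, ‖O - O - τ • w‖ ≤ e := fun O w => ⟨0, by simpa using he.le⟩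
  obtain ⟨i, j, k, hij, hik, hjk, h1, h2, h3⟩ := exists_transitive_triple
    (R := fun i j : Fin 4 => ∃ τ : ℝ, ‖ω (.inl j) - ω (.inl i) - τ • v (.inl i)‖ ≤ e)
    fun i j hij => hnear (.inl i) (.inl j) (by simpa using hij)
  set a := ω (.inl i) with ha
  set b := ω (.inl j) with hb
  set c := ω (.inl k) with hc
  -- The whole configuration is near the line through `a` and `b`.
  have key : ∀ l : Fin 3, ∃ σ : ℝ, ‖ω (.inr l) - a - σ • (b - a)‖ ≤ 3528 * e := fun l => by
    rcases hnear (.inl i) (.inr l) (by simp) with hi | hi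
    · obtain ⟨σ, -, hσ⟩ := exists_near_line he (by linarith) (self a _) h1 hi (hsep i j hij)
        (hdiam _ _)
      exact ⟨σ, by linarith⟩
    rcases hnear (.inl j) (.inr l) (by simp) with hj | hj
    · obtain ⟨σ, -, hσ⟩ := exists_near_line he (by linarith) (self a _) h1 h2 (hsep i j hij)
        (hdiam _ _)
      obtain ⟨σ', hσ1, hσ'⟩ := exists_near_line he (by linarith) (self b _) h3 hj (hsep j k hjk)
        (hdiam _ _)
      refine ⟨1 + σ' * (σ - 1), ?_⟩
      have e1 : ω (.inr l) - a - (1 + σ' * (σ - 1)) • (b - a) =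
          (ω (.inr l) - b - σ' • (c - b)) + σ' • (c - a - σ • (b - a)) := by module
      have e2 : ‖σ' • (c - a - σ • (b - a))‖ ≤ 41 * (84 * e) := by
        rw [norm_smul, Real.norm_eq_abs]
        exact mul_le_mul hσ1 hσ (norm_nonneg _) (by norm_num)
      rw [e1]
      linarith [norm_add_le (ω (.inr l) - b - σ' • (c - b)) (σ' • (c - a - σ • (b - a)))]
    · obtain ⟨σ, -, hσ⟩ := exists_near_line he (by linarith) hi hj (self _ _) (hsep i j hij)
        (hdiam _ _)
      exact ⟨σ, by linarith⟩
  obtain ⟨σ, -, hσ⟩ := exists_near_line (by positivity) (by linarith) (key 0) (key 1) (key 2)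
    hsep' (hdiam _ _)
  exact ⟨σ, by linarith⟩

end Lines

/-! ### Lower bounds for the tangent-point energies -/

section TangentPoint

variable {γ : ℝ → E3} {x y z : E3} {h p : ℝ}

lemma tangentPointRadius_le {e M : ℝ} (he : 0 < e) (hfar : e ≤ Metric.infDist y (tangentLine γ x))
    (hd : dist x y ≤ M) : tangentPointRadius γ x y ≤ ENNReal.ofReal (M ^ 2 / (2 * e)) := by
  rw [tangentPointRadius, ENNReal.ofReal_div_of_pos (by positivity)]
  gcongr

/-- Near the vertices of a thick inscribed triangle, and near four further points of the loop at
comparable distances, there is a definite amount of pairs of points away from each other's tangent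
lines. -/
lemma exists_le_measure_farPairs (hγ : IsUnitLoop γ) (hs : IsSimpleLoop γ) (hx : x ∈ range γ)
    (hy : y ∈ range γ) (hz : z ∈ range γ) (h0 : 0 < h) (hxy : dist x y ≤ dist x z)
    (hxz : dist x z ≤ 2 * dist x y) (H : ∀ τ : ℝ, h ≤ ‖z - x - τ • (y - x)‖) :
    ∃ u w : E3, dist u w ≤ 3 * dist x y ∧ ENNReal.ofReal (h / 100) ^ 2 ≤
      49 * ((μH[1]).restrict (range γ)).prod ((μH[1]).restrict (range γ))
        (farPairs γ (h / 1000000) ∩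
          Metric.closedBall u (h / 100) ×ˢ Metric.closedBall w (h / 100)) := by
  have hc := hγ.lipschitz.continuous
  have hh := H 0
  rw [zero_smul, sub_zero, ← dist_eq_norm, dist_comm] at hh
  have hd : 0 < dist x y := by linarith
  have hfin : IsFiniteMeasure ((μH[1] : Measure E3).restrict (range γ)) :=
    ⟨by rw [Measure.restrict_apply_univ, hγ.length_one]; exact ENNReal.one_lt_top⟩
  have hP : ∀ i : Fin 4, ∃ q ∈ range γ, dist x q = ((i : ℝ) + 1) / 4 * dist x y := fun i => by
    have hi : ((i : ℕ) : ℝ) + 1 ≤ 4 := by exact_mod_cast i.2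
    exact (isPreconnected_range hc).intermediate_value hx hy (f := fun q => dist x q) (by fun_prop)
      ⟨by rw [dist_self]; positivity, by nlinarith⟩
  choose P hPm hPd using hP
  set c : Fin 4 ⊕ Fin 3 → E3 := Sum.elim P ![x, y, z] with hcdef
  have hcm : ∀ i, c i ∈ range γ := by
    rintro (i | i)
    · exact hPm i
    · fin_cases i <;> assumption
  have hsmall : ∀ i, i ≠ .inr 2 → dist x (c i) ≤ dist x y := by
    rintro (i | i) hi
    · have hi : ((i : ℕ) : ℝ) + 1 ≤ 4 := by exact_mod_cast i.2
      change dist x (P i) ≤ _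
      rw [hPd]
      nlinarith
    · fin_cases i
      · change dist x x ≤ _
        rw [dist_self]; exact hd.le
      · exact le_rfl
      · exact absurd rfl hi
  have hcc : ∀ i j, dist (c i) (c j) ≤ 3 * dist x y := fun i j => by
    by_cases hij : i = j
    · rw [hij, dist_self]; positivity
    have ht := dist_triangle_left (c i) (c j) x
    by_cases hi : i = .inr 2
    · have h1 := hsmall j (fun h => hij (hi.trans h.symm))
      have h2 : dist x (c i) ≤ 2 * dist x y := by rw [hi]; exact hxz
      linarith
    · have h1 := hsmall i hi
      have h2 : dist x (c j) ≤ 2 * dist x y := by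
        by_cases hj : j = .inr 2
        · rw [hj]; exact hxz
        · linarith [hsmall j hj]
      linarith
  have hball : ∀ i, ENNReal.ofReal (h / 100) ≤
      (μH[1]).restrict (range γ) (Metric.closedBall (c i) (h / 100)) := fun i =>
    hγ.le_measure_closedBall (hcm i) (by linarith [hγ.dist_le_one hx hz])
  obtain ⟨i, j, hij⟩ := exists_le_measure_prod (ν := (μH[1]).restrict (range γ))
    (S := fun i => Metric.closedBall (c i) (h / 100)) (B := farPairs γ (h / 1000000))
    (fun i => ((ENNReal.ofReal_pos.2 (by positivity)).trans_le (hball i)).ne')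
    (measurableSet_farPairs (hs.measurable_tangentAt hc) _) (by
      intro ω hω
      by_contra! hcon
      have hω' : ∀ i, dist (ω i) (c i) ≤ h / 100 := hω
      have hdiff : ∀ i j, dist (c i) (c j) - h / 50 ≤ ‖ω j - ω i‖ := fun i j => by
        rw [← dist_eq_norm, dist_comm (ω j)]
        have := dist_triangle4 (c i) (ω i) (ω j) (c j)
        linarith [hω' i, hω' j, dist_comm (c i) (ω i)]
      have hnear : ∀ i j, i ≠ j →
          (∃ τ : ℝ, ‖ω j - ω i - τ • tangentAt γ (ω i)‖ ≤ h / 1000000) ∨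
            ∃ τ : ℝ, ‖ω i - ω j - τ • tangentAt γ (ω j)‖ ≤ h / 1000000 := fun i j hij => by
        have h1 := hcon i j hij
        simp only [farPairs, mem_ofPred_eq, not_and_or, not_le, infDist_tangentLine_lt_iff] at h1
        exact h1.imp (fun ⟨τ, h⟩ => ⟨τ, h.le⟩) (fun ⟨τ, h⟩ => ⟨τ, h.le⟩)
      obtain ⟨σ, hσ⟩ := exists_near_line_of_tournament (D := dist x y / 5)
        (v := fun i => tangentAt γ (ω i)) (by positivity) (by linarith) hnear
        (fun i j hij => by
          have hij' : (1 : ℝ) ≤ |((j : ℕ) : ℝ) - (i : ℕ)| := by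
            have h1 : (i : ℕ) ≠ j := fun he => hij (Fin.ext he)
            have : (1 : ℤ) ≤ |((j : ℕ) : ℤ) - (i : ℕ)| := Int.one_le_abs (by omega)
            exact_mod_cast this
          have h1 := abs_dist_sub_le (P j) (P i) x
          rw [dist_comm _ x, dist_comm _ x, hPd, hPd,
            show (((j : ℕ) : ℝ) + 1) / 4 * dist x y - (((i : ℕ) : ℝ) + 1) / 4 * dist x y =
              (((j : ℕ) : ℝ) - (i : ℕ)) * (dist x y / 4) by ring, abs_mul,
            abs_of_pos (show 0 < dist x y / 4 by positivity)] at h1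
          have h2 := hdiff (.inl i) (.inl j)
          change dist (P i) (P j) - h / 50 ≤ _ at h2
          rw [dist_comm] at h2
          nlinarith)
        (by
          have h2 := hdiff (.inr 0) (.inr 1)
          change dist x y - h / 50 ≤ _ at h2
          linarith)
        (fun i j => by
          rw [← dist_eq_norm]
          have := dist_triangle4 (ω i) (c i) (c j) (ω j)
          linarith [hω' i, hω' j, dist_comm (c j) (ω j), hcc i j])
      have := half_le_norm_of_dist_le hxy hxz H (show h / 100 ≤ h / 24 by linarith)
        (hω' (.inr 0)) (hω' (.inr 1)) (hω' (.inr 2)) σ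
      linarith)
  refine ⟨c i, c j, hcc i j, ?_⟩
  rw [pow_two]
  refine (mul_le_mul' (hball i) (hball j)).trans (hij.trans (le_of_eq ?_))
  simp only [Fintype.card_sum, Fintype.card_fin]
  norm_num

lemma le_energy_TP_and_TPsym (hγ : IsUnitLoop γ) (hs : IsSimpleLoop γ) (hp : 0 < p)
    (hx : x ∈ range γ) (hy : y ∈ range γ) (hz : z ∈ range γ) (h0 : 0 < h)
    (hxy : dist x y ≤ dist x z) (hxz : dist x z ≤ 2 * dist x y)
    (H : ∀ τ : ℝ, h ≤ ‖z - x - τ • (y - x)‖) :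
    ENNReal.ofReal (((4 * dist x y) ^ 2 / (2 * (h / 1000000)))⁻¹ ^ p) *
        ENNReal.ofReal (h / 100) ^ 2 ≤ 49 * CurvatureEnergy.energy p γ .TP ∧
      ENNReal.ofReal (((4 * dist x y) ^ 2 / (2 * (h / 1000000)))⁻¹ ^ p) *
        ENNReal.ofReal (h / 100) ^ 2 ≤ 49 * CurvatureEnergy.energy p γ .TPsym := by
  have hh := H 0
  rw [zero_smul, sub_zero, ← dist_eq_norm, dist_comm] at hh
  have hd : 0 < dist x y := by linarith
  obtain ⟨u, w, huw, hm⟩ := exists_le_measure_farPairs hγ hs hx hy hz h0 hxy hxz H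
  have hfin : IsFiniteMeasure ((μH[1] : Measure E3).restrict (range γ)) :=
    ⟨by rw [Measure.restrict_apply_univ, hγ.length_one]; exact ENNReal.one_lt_top⟩
  set K : ℝ := (4 * dist x y) ^ 2 / (2 * (h / 1000000)) with hK
  have hK0 : 0 < K := by positivity
  have he : 0 < h / 1000000 := by positivity
  have hS : MeasurableSet (farPairs γ (h / 1000000) ∩
      Metric.closedBall u (h / 100) ×ˢ Metric.closedBall w (h / 100)) :=
    (measurableSet_farPairs (hs.measurable_tangentAt hγ.lipschitz.continuous) _).inter
      (Metric.isClosed_closedBall.measurableSet.prod Metric.isClosed_closedBall.measurableSet)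
  have hR : ∀ a b : E3, (a, b) ∈ farPairs γ (h / 1000000) ∩
      Metric.closedBall u (h / 100) ×ˢ Metric.closedBall w (h / 100) →
      tangentPointRadius γ a b ≤ ENNReal.ofReal K ∧
        tangentPointRadius γ b a ≤ ENNReal.ofReal K := by
    rintro a b ⟨⟨h1, h2⟩, h3, h4⟩
    have hab : dist a b ≤ 4 * dist x y := by
      have h3' : dist a u ≤ h / 100 := h3
      have h4' : dist b w ≤ h / 100 := h4
      have := dist_triangle4 a u w b
      linarith [dist_comm w b]
    exact ⟨tangentPointRadius_le he h1 hab, tangentPointRadius_le he h2 (by rwa [dist_comm])⟩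
  constructor
  · refine (mul_le_mul_right hm _).trans ?_
    rw [mul_left_comm]
    exact mul_le_mul_right (mul_prod_measure_le_lintegral hS fun a b hab =>
      ofReal_le_inv_rpow hK0 hp.le (hR a b hab).1) _
  · refine (mul_le_mul_right hm _).trans ?_
    rw [mul_left_comm]
    refine mul_le_mul_right (mul_prod_measure_le_lintegral hS fun a b hab => ?_) _
    have h1 : tangentPointRadius γ a b * tangentPointRadius γ b a ≤ ENNReal.ofReal (K ^ 2) := by
      rw [pow_two, ENNReal.ofReal_mul hK0.le]
      exact mul_le_mul' (hR a b hab).1 (hR a b hab).2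
    have h2 := ofReal_le_inv_rpow (p := p / 2) (by positivity) (by positivity) h1
    rwa [← inv_pow, ← Real.rpow_natCast, ← Real.rpow_mul (by positivity), Nat.cast_ofNat,
      mul_div_cancel₀ _ two_ne_zero] at h2

end TangentPoint

/-! ### From finite energy to straightness -/

lemma CurvatureEnergy.criticalExponent_pos (F : CurvatureEnergy) : 0 < F.criticalExponent := by
  cases F <;> norm_num [CurvatureEnergy.criticalExponent]

/-- A triangle of height `h` and diameter comparable to `d` inscribed in the loop costs an energy
of the order `h ^ q * (h / d ^ 2) ^ p`, where `q` is the critical exponent. -/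
lemma CurvatureEnergy.exists_le_energy (F : CurvatureEnergy) {p : ℝ}
    (hp : F.criticalExponent < p) :
    ∃ C : ℝ, 0 < C ∧ ∀ γ : ℝ → E3, IsUnitLoop γ → IsSimpleLoop γ → ∀ x ∈ range γ,
      ∀ y ∈ range γ, ∀ z ∈ range γ, dist x y ≤ dist x z → dist x z ≤ 2 * dist x y →
      ∀ h : ℝ, 0 < h → (∀ τ : ℝ, h ≤ ‖z - x - τ • (y - x)‖) →
        ENNReal.ofReal (C * (h ^ F.criticalExponent * (h / dist x y ^ 2) ^ p)) ≤
          F.energy p γ := by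
  have hp0 : 0 < p := F.criticalExponent_pos.trans hp
  have expand : ∀ {a h d : ℝ}, 0 < a → 0 < h → (a * d ^ 2 / h)⁻¹ ^ p = a⁻¹ ^ p * (h / d ^ 2) ^ p :=
    fun {a h d} ha hh => by
      rw [← Real.mul_rpow (by positivity) (by positivity), inv_div, mul_comm a, div_mul_eq_div_div,
        div_eq_inv_mul _ a]
  have tp : ∀ {h d : ℝ}, 0 < h → ENNReal.ofReal
      (2000000⁻¹ ^ p * (1 / 100) ^ 2 / 49 * 4⁻¹ ^ p * (h ^ (2 : ℝ) * (h / d ^ 2) ^ p)) =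
      ENNReal.ofReal (((4 * d) ^ 2 / (2 * (h / 1000000)))⁻¹ ^ p) * ENNReal.ofReal (h / 100) ^ 2 / 49 :=
    fun {h d} hh => by
      have e : (4 * d) ^ 2 / (2 * (h / 1000000)) = (2000000 * 4) * d ^ 2 / h := by
        field_simp; ring
      rw [e, expand (by norm_num) hh, ← ENNReal.ofReal_pow (by positivity),
        ← ENNReal.ofReal_mul (by positivity),
        show (49 : ℝ≥0∞) = ENNReal.ofReal 49 by norm_num,
        ← ENNReal.ofReal_div_of_pos (by norm_num), mul_inv,
        Real.mul_rpow (by norm_num) (by norm_num), Real.rpow_ofNat]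
      congr 1; ring
  cases F with
  | M =>
    refine ⟨12⁻¹ ^ p * (1 / 24) ^ 3, by positivity, fun γ hγ hs x hx y hy z hz hxy hxz h h0 H => ?_⟩
    refine le_trans (le_of_eq ?_) (le_energy_M hγ hp0 hx hy hz h0 hxy hxz H)
    rw [expand (by norm_num) h0, ← ENNReal.ofReal_pow (by positivity),
      ← ENNReal.ofReal_mul (by positivity), CurvatureEnergy.criticalExponent, Real.rpow_ofNat]
    congr 1; ring
  | I =>
    refine ⟨12⁻¹ ^ p * (1 / 24) ^ 2, by positivity, fun γ hγ hs x hx y hy z hz hxy hxz h h0 H => ?_⟩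
    refine le_trans (le_of_eq ?_) (le_energy_I hγ hp0 hx hy hz h0 hxy hxz H)
    rw [expand (by norm_num) h0, ← ENNReal.ofReal_pow (by positivity),
      ← ENNReal.ofReal_mul (by positivity), CurvatureEnergy.criticalExponent, Real.rpow_ofNat]
    congr 1; ring
  | U =>
    refine ⟨12⁻¹ ^ p * (1 / 24), by positivity, fun γ hγ hs x hx y hy z hz hxy hxz h h0 H => ?_⟩
    refine le_trans (le_of_eq ?_) (le_energy_U hγ hp0 hx hy hz h0 hxy hxz H)
    rw [expand (by norm_num) h0, ← ENNReal.ofReal_mul (by positivity),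
      CurvatureEnergy.criticalExponent, Real.rpow_one]
    congr 1; ring
  | TP =>
    refine ⟨2000000⁻¹ ^ p * (1 / 100) ^ 2 / 49 * 4⁻¹ ^ p, by positivity,
      fun γ hγ hs x hx y hy z hz hxy hxz h h0 H => ?_⟩
    rw [CurvatureEnergy.criticalExponent, tp h0]
    exact ENNReal.div_le_of_le_mul' (le_energy_TP_and_TPsym hγ hs hp0 hx hy hz h0 hxy hxz H).1
  | TPsym =>
    refine ⟨2000000⁻¹ ^ p * (1 / 100) ^ 2 / 49 * 4⁻¹ ^ p, by positivity,
      fun γ hγ hs x hx y hy z hz hxy hxz h h0 H => ?_⟩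
    rw [CurvatureEnergy.criticalExponent, tp h0]
    exact ENNReal.div_le_of_le_mul' (le_energy_TP_and_TPsym hγ hs hp0 hx hy hz h0 hxy hxz H).2

/-- A simple loop of finite energy is straight at a scale given by its energy. -/
lemma CurvatureEnergy.exists_straight (F : CurvatureEnergy) {p : ℝ}
    (hp : F.criticalExponent < p) :
    ∃ c : ℝ, 0 < c ∧ ∀ γ : ℝ → E3, IsUnitLoop γ → IsSimpleLoop γ → F.energy p γ < ∞ →
      0 < (F.energy p γ).toReal → Straight (range γ) (1 / 100)
        (c * (F.energy p γ).toReal ^ (-(1 / (p - F.criticalExponent)))) := by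
  obtain ⟨C, hC, hF⟩ := F.exists_le_energy hp
  have hq := F.criticalExponent_pos
  set q := F.criticalExponent
  have hp0 : 0 < p := hq.trans hp
  have hpq : 0 < p - q := by linarith
  set κ : ℝ := (p - q) / (p + q) with hκ
  have hκ0 : 0 < κ := by positivity
  have h2κ : (2 : ℝ) ^ (-κ) < 1 := Real.rpow_lt_one_of_one_lt_of_neg one_lt_two (by linarith)
  set M : ℝ := 2 * C⁻¹ ^ (1 / (p + q)) / (1 - 2 ^ (-κ)) with hM
  have hM0 : 0 < M := div_pos (by positivity) (by linarith)
  refine ⟨(100 * M)⁻¹ ^ (1 / κ), by positivity, fun γ hγ hs hfin hpos => ?_⟩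
  set E := (F.energy p γ).toReal with hE
  have hflat := straight_of_flat (A := (C⁻¹ * E) ^ (1 / (p + q))) (κ := κ)
    (isPreconnected_range hγ.lipschitz.continuous) (by positivity) hκ0
    (fun x hx y hy z hz hyx hxy hxz h H => by
      rcases le_or_gt h 0 with h0 | h0
      · exact h0.trans (by positivity)
      have hd : 0 < dist x y := dist_pos.2 hyx.symm
      have hD : 0 < dist x z := hd.trans_le hxy
      have h1 := (ENNReal.ofReal_le_iff_le_toReal hfin.ne).1
        (hF γ hγ hs x hx y hy z hz hxy hxz h h0 H)
      have h2 : C * (h ^ q * (h / dist x z ^ 2) ^ p) ≤ E := by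
        refine le_trans ?_ h1
        gcongr
      have h3 : h ^ (p + q) ≤ C⁻¹ * E * dist x z ^ (2 * p) := by
        rw [Real.div_rpow h0.le (by positivity), ← Real.rpow_natCast, ← Real.rpow_mul hD.le,
          Nat.cast_ofNat, mul_div_assoc', ← Real.rpow_add h0, add_comm q, mul_div_assoc',
          div_le_iff₀ (by positivity)] at h2
        rw [mul_assoc, inv_mul_eq_div, le_div_iff₀ hC]
        linarith
      have h4 : h = (h ^ (p + q)) ^ (1 / (p + q)) := by
        rw [← Real.rpow_mul h0.le, mul_one_div_cancel (by positivity), Real.rpow_one]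
      have h5 : (h ^ (p + q)) ^ (1 / (p + q)) ≤
          (C⁻¹ * E * dist x z ^ (2 * p)) ^ (1 / (p + q)) := by gcongr
      rw [← h4, Real.mul_rpow (by positivity) (by positivity), ← Real.rpow_mul hD.le] at h5
      refine h5.trans (le_of_eq ?_)
      have h6 : 2 * p * (1 / (p + q)) = κ + 1 := by
        rw [hκ]; field_simp; ring
      rw [h6, Real.rpow_add_one hD.ne', mul_assoc])
    (r := (100 * M)⁻¹ ^ (1 / κ) * E ^ (-(1 / (p - q))))
  -- The scale is chosen so that the energy cancels from the bound.
  have hval : 2 * (C⁻¹ * E) ^ (1 / (p + q)) / (1 - 2 ^ (-κ)) *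
      ((100 * M)⁻¹ ^ (1 / κ) * E ^ (-(1 / (p - q)))) ^ κ = 1 / 100 := by
    have e1 : (-(1 / (p - q))) * κ = -(1 / (p + q)) := by
      rw [hκ]; field_simp
    rw [Real.mul_rpow (by positivity) hpos.le, Real.mul_rpow (by positivity) (by positivity),
      ← Real.rpow_mul (by positivity), ← Real.rpow_mul hpos.le, one_div_mul_cancel hκ0.ne',
      Real.rpow_one, e1, Real.rpow_neg hpos.le]
    have e2 : E ^ (1 / (p + q)) ≠ 0 := (Real.rpow_pos_of_pos hpos _).ne'
    have e3 : 2 * (C⁻¹ ^ (1 / (p + q)) * E ^ (1 / (p + q))) / (1 - 2 ^ (-κ)) =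
        M * E ^ (1 / (p + q)) := by rw [hM]; ring
    rw [e3]
    field_simp
  rwa [hval] at hflat

end MengerKnot

theorem theorem4p1 (F : MengerKnot.CurvatureEnergy) (p : ℝ) (hp : F.criticalExponent < p) :
    ∃ δ : ℝ, 0 < δ ∧ δ < 1 ∧
      ∀ γ : ℝ → MengerKnot.E3, MengerKnot.IsUnitLoop γ → MengerKnot.IsSimpleLoop γ →
        F.energy p γ < ∞ →
        ∀ (N : ℕ) (t : Fin (N + 1) → ℝ), MengerKnot.IsCyclicPartition t →
          (∀ i : Fin N, t i.succ - t i.castSucc ≤ 1 / 2) →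
          (∀ i : Fin N, dist (γ (t i.castSucc)) (γ (t i.succ)) <
            δ * (F.energy p γ).toReal ^ (-(1 / (p - F.criticalExponent)))) →
          MengerKnot.AmbientIsotopic (range γ) (MengerKnot.inscribedPolygon γ t) := by
  obtain ⟨c, hc, hS⟩ := F.exists_straight hp
  refine ⟨min (c / 16) (1 / 2), by positivity, (min_le_right _ _).trans_lt (by norm_num),
    fun γ hγ hs hfin N t ht hhalf hd => ?_⟩
  have hpos : 0 < (F.energy p γ).toReal := by
    refine ENNReal.toReal_nonneg.lt_of_ne fun h0 => ?_
    have hN : N ≠ 0 := by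
      rintro rfl
      have := ht.2
      rw [Fin.last_zero] at this
      linarith
    -- A negative power of `0` is `0`, so no edge could satisfy the hypothesis.
    have h1 := hd ⟨0, Nat.pos_of_ne_zero hN⟩
    have hne : -(1 / (p - F.criticalExponent)) ≠ 0 :=
      neg_ne_zero.2 (one_div_ne_zero (sub_pos.2 hp).ne')
    rw [← h0, Real.zero_rpow hne, mul_zero] at h1
    exact absurd h1 (not_lt.2 dist_nonneg)
  refine (hS γ hγ hs hfin hpos).ambientIsotopic hγ hs ht hhalf fun i => (hd i).trans_le ?_
  have h1 : 0 ≤ (F.energy p γ).toReal ^ (-(1 / (p - F.criticalExponent))) := by positivity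
  calc _ ≤ c / 16 * (F.energy p γ).toReal ^ (-(1 / (p - F.criticalExponent))) :=
        mul_le_mul_of_nonneg_right (min_le_left _ _) h1
    _ = _ := by ring
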